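/- **Notation.** Write $\mathbf e(z)=e^{2\pi\imath z}$, let $\mathrm{Im}\,\tau>0$, $q=\mathbf e(\tau)$, $\Lambda=\mathbb Z+\tau\mathbb Z$, and let $\theta(z)=2q^{1/8}\sin(\pi z)\prod_{n\ge1}(1-q^n)(1-q^n\mathbf e(z))(1-q^n\mathbf e(-z))$ be the odd theta function. Put $$\phi(u,z)=\frac{\theta(u+z)\theta'(0)}{\theta(u)\theta(z)},\qquad E_2(z)=-\partial_z^2\log\theta(z),\qquad g^{(m)}(u,z)=\mathbf e\!\left(\tfrac{mz}{r}\right)\phi\!\left(u+\tfrac{m\tau}{r},z\right)\quad(m\in\mathbb Z).$$ Let $\mathfrak g$ be a simple complex Lie algebra with Cartan subalgebra $\mathfrak h$ and simple roots $\Pi$. Let $\nu$ be a diagram automorphism of $\mathfrak g$ of order $r\in\{2,3\}$ (it preserves $\mathfrak h$, permutes $\Pi$ by $\bar\nu$, and permutes a set of simple root vectors). Let $(\cdot,\cdot)$ be a non-zero multiple of the Killing form; it plays the role of $\mathrm{tr}$. Put $\omega=\mathbf e(1/r)$, $\mathfrak g_m=\{x:\nu x=\omega^m x\}$, $\mathfrak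 h_m=\mathfrak h\cap\mathfrak g_m$. For a root $\alpha$ let $\tilde\alpha=\frac1r\sum_{j<r}\bar\nu^j\alpha$, and put $x_{\tilde\alpha}=\tilde\alpha(x)$ for $x\in\mathfrak h$. Choose root vectors $E_\alpha$ with $(E_\alpha,E_{-\alpha})=1$, and choose for each $\bar\nu$-orbit of roots a representative $\alpha$, compatibly with $\alpha\mapsto-\alpha$. Let $\tilde R_m$ be the set of non-zero $\mathfrak h_0$-weights $\tilde\alpha$ of $\mathfrak g_m$: those with $\bar\nu\alpha\ne\alpha$, together with those with $\bar\nu\alpha=\alpha$, $\nu E_\alpha=\omega^mE_\alpha$. (If $\mathfrak g$ is not of type $A_{2n}$, $\tilde R_0=\tilde R$ is the set of all $\tilde\alpha$ and $\tilde R_m=R_s=\{\tilde\alpha:\bar\nu\alpha\neq\alpha\}$ for $m\ne0$.) For $\tilde\alpha\in\tilde R_m$ put $\mathfrak t^m_{\tilde\alpha}=\sum_{j<r}\omega^{-jm}\nu^jE_\alpha$, $\ell_{\tilde\alpha}=r$ if $\bar\nu\alpha\ne\alpha$, and $\mathfrak t^m_{\tilde\alpha}=E_\alpha$, $\ell_{\tilde\alpha}=1$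 if $\bar\nu\alpha=\alpha$. Let $(\mathfrak e^m_k)_{1\le k\le n_m}$ be bases of $\mathfrak h_m$ with $(\mathfrak e^0_j,\mathfrak e^0_k)=\delta_{jk}$ and $(\mathfrak e^m_j,\mathfrak e^{r-m}_k)=\delta_{jk}$ for $m\ne0$. Let $\mathbf u\in\mathfrak h_0$, let $\varpi$ be an element of the weight lattice $\{x\in\mathfrak h:\alpha(x)\in\mathbb Z\text{ for all roots }\alpha\}$ ($\varpi=0$ for the trivial characteristic class, $\varpi=\varpi_j$ a fundamental weight for the class $\mathbf e(\nu\varpi_j-\varpi_j)$), and let $\bar\varpi=\frac1r\sum_{j<r}\nu^j\varpi$. Put $x=\mathbf u+\varpi$ and assume $x_{\tilde\alpha}+m\tau/r\notin\Lambda$ for all $0\le m<r$, $\tilde\alpha\in\tilde R_m$. For complex numbers $v_k$, $S^m_k$ ($1\le m<r$), $S_m^{\tilde\alpha}$ ($0\le m<r$) put $$S_0=\sum_{\tilde\alpha\in\tilde R_0}S_0^{\tilde\alpha}\mathfrak t^0_{\tilde\alpha},\qquad S_m=\sum_kS^m_k\mathfrak e^m_k+\sum_{\tilde\alpha\in\tilde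 R_m}S_m^{\tilde\alpha}\mathfrak t^m_{\tilde\alpha}\ (m\neq0),\qquad \mathbf S=\sum_{m<r}S_m,\qquad C_2=\tfrac12(\mathbf S,\mathbf S),$$ $$L_0(z)=\sum_kv_k\mathfrak e^0_k+\sum_{\tilde\alpha\in\tilde R_0}S_0^{\tilde\alpha}g^{(0)}(-x_{\tilde\alpha},z)\mathfrak t^0_{\tilde\alpha},$$ $$L_m(z)=\sum_kS^m_kg^{(-m)}(0,z)\mathfrak e^m_k+\sum_{\tilde\alpha\in\tilde R_m}S_m^{\tilde\alpha}g^{(-m)}(-x_{\tilde\alpha},z)\mathfrak t^m_{\tilde\alpha}\quad(m\ne0),\qquad L=\sum_{m<r}L_m .$$ **Statement.** The Lax operator $L$, a function of $t=\mathbf e(z/r)$, is holomorphic for $z\notin\Lambda$, and there satisfies 1. $\nu(L(z))=L(z-1)$, that is $\nu(L(t))=L(t\omega^{-1})$; 2. $L(z+\tau)=\mathrm{Ad}_{\mathbf e(\mathbf u+\bar\varpi)}L(z)$; moreover, 3. $\lim_{z\to0}zL(z)=\mathbf S$. For all $z\notin\Lambda$, $$\tfrac12(L(z),L(z))=H+E_2(z)\,C_2,\qquad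 H=H_0+H',$$ where $$H_0=\tfrac12\sum_kv_k^2-\tfrac12\sum_{\tilde\alpha\in\tilde R_0}\ell_{\tilde\alpha}S_0^{\tilde\alpha}S_0^{-\tilde\alpha}E_2(\mathbf u_{\tilde\alpha}+\varpi_{\tilde\alpha}),$$ $$H'=\sum_{m=1}^{r-1}\Big(-\tfrac12\sum_kS^m_kS^{r-m}_kE_2\big(\tfrac{m\tau}r\big)-\tfrac12\sum_{\tilde\alpha\in\tilde R_{r-m}}\ell_{\tilde\alpha}S_{r-m}^{\tilde\alpha}S_m^{-\tilde\alpha}E_2\big(\mathbf u_{\tilde\alpha}+\varpi_{\tilde\alpha}-\tfrac{m\tau}r\big)\Big).$$ More precisely, $\tfrac12(L_0,L_0)=H_0+\tfrac12E_2(z)(S_0,S_0)$ and $\tfrac12\sum_{m=1}^{r-1}(L_m,L_{r-m})=H'+\tfrac12E_2(z)\sum_{m=1}^{r-1}(S_m,S_{r-m})$. -/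

import Mathlib

open scoped Topology

noncomputable section

namespace TwistedCM

/-! ### Elliptic functions -/

/-- `e(z) = exp (2 π i z)`. -/
def e (z : ℂ) : ℂ := Complex.exp (2 * Real.pi * Complex.I * z)

/-- The period lattice `ℤ + τ ℤ`. -/
def periodLattice (τ : ℂ) : Set ℂ := {z | ∃ a b : ℤ, z = a + b * τ}

/-- The odd theta function
`θ(z|τ) = 2 q^{1/8} sin(π z) ∏_{n ≥ 1} (1 - qⁿ)(1 - qⁿ t)(1 - qⁿ t⁻¹)`, `q = e(τ)`, `t = e(z)`. -/
def theta (τ z : ℂ) : ℂ :=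
  2 * Complex.exp (Real.pi * Complex.I * τ / 4) * Complex.sin (Real.pi * z) *
    ∏' n : ℕ, ((1 - e ((n + 1) * τ)) * (1 - e ((n + 1) * τ) * e z) *
      (1 - e ((n + 1) * τ) * e (-z)))

/-- The Kronecker function `φ(u,z|τ) = θ(u+z) θ'(0) / (θ(u) θ(z))`. -/
def kronecker (τ u z : ℂ) : ℂ :=
  theta τ (u + z) * deriv (theta τ) 0 / (theta τ u * theta τ z)

/-- The twisted Kronecker function `g^{(m)} = e(m z / r) φ(u + m τ / r, z | τ)`, where `m` may be
negative; it is a function of `t = e(z / r)` and `s = e(u)`. -/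
def kroneckerTwist (τ : ℂ) (r : ℕ) (m : ℤ) (u z : ℂ) : ℂ :=
  e (m * z / r) * kronecker τ (u + m * τ / r) z

/-- The first Eisenstein function `E₁(z|τ) = ∂_z log θ(z|τ)`. -/
def eisensteinOne (τ z : ℂ) : ℂ := logDeriv (theta τ) z

/-- The second Eisenstein function `E₂(z|τ) = - ∂_z E₁(z|τ) = - ∂_z² log θ(z|τ)`. -/
def eisensteinTwo (τ z : ℂ) : ℂ := - deriv (eisensteinOne τ) z

/-! ### Diagram automorphisms -/

section Lie

variable {𝔤 : Type*} [LieRing 𝔤] [LieAlgebra ℂ 𝔤] [FiniteDimensional ℂ 𝔤]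
  [LieAlgebra.IsSimple ℂ 𝔤]

/-- A diagram automorphism of `(𝔤, 𝔥, Π)`: an automorphism of `𝔤` that preserves `𝔥`, permutes the
simple roots, and permutes some choice of simple root vectors. The induced permutation of the
weights is `perm`, with `perm α = α ∘ ν⁻¹`. -/
structure DiagramAutomorphism (H : LieSubalgebra ℂ 𝔤) [H.IsCartanSubalgebra]
    (b : (LieAlgebra.IsKilling.rootSystem H).Base) where
  toEquiv : 𝔤 ≃ₗ⁅ℂ⁆ 𝔤
  map_mem : ∀ h ∈ H, toEquiv h ∈ H
  perm : Equiv.Perm (LieModule.Weight ℂ H 𝔤)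
  perm_apply : ∀ (α : LieModule.Weight ℂ H 𝔤) (h : H),
    (perm α) ⟨toEquiv h, map_mem h h.2⟩ = α h
  perm_simple : ∀ i ∈ b.support, ∃ j ∈ b.support, perm i.1 = j.1
  pinned : ∃ x : LieModule.Weight ℂ H 𝔤 → 𝔤, ∀ i ∈ b.support,
    x i.1 ∈ LieAlgebra.rootSpace H i.1 ∧ x i.1 ≠ 0 ∧ toEquiv (x i.1) = x (perm i.1)

variable {H : LieSubalgebra ℂ 𝔤} [H.IsCartanSubalgebra]
  {b : (LieAlgebra.IsKilling.rootSystem H).Base}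

/-- The automorphism as a linear operator on `𝔤`. -/
def DiagramAutomorphism.lin (ν : DiagramAutomorphism H b) : Module.End ℂ 𝔤 :=
  (ν.toEquiv : 𝔤 →ₗ[ℂ] 𝔤)

/-- The invariant form: `c` times the Killing form (`c ≠ 0` fixes the normalization). -/
def form (c : ℂ) (x y : 𝔤) : ℂ := c * killingForm ℂ 𝔤 x y

/-- The `ν`-invariant part `r⁻¹ ∑_j ν^j x` of `x`. -/
def invariantPart (ν : DiagramAutomorphism H b) (r : ℕ) (x : 𝔤) : 𝔤 :=
  (r : ℂ)⁻¹ • ∑ j ∈ Finset.range r, (ν.lin ^ j) x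

/-- The value at `x ∈ 𝔥` of the averaged root `α̃ = r⁻¹ ∑_j ν̄^j α`. -/
def avgRoot (ν : DiagramAutomorphism H b) (r : ℕ) (α : LieModule.Weight ℂ H 𝔤) (x : H) : ℂ :=
  (r : ℂ)⁻¹ * ∑ j ∈ Finset.range r, ((ν.perm ^ j) α) x

/-- `Ad_{e(x)} = exp (2 π i ad x)`, computed in a basis of `𝔤`. -/
def AdExp (x : 𝔤) : Module.End ℂ 𝔤 :=
  Matrix.toLin (Module.finBasis ℂ 𝔤) (Module.finBasis ℂ 𝔤)
    (NormedSpace.exp ((2 * Real.pi * Complex.I : ℂ) •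
      LinearMap.toMatrix (Module.finBasis ℂ 𝔤) (Module.finBasis ℂ 𝔤)
        (LieAlgebra.ad ℂ 𝔤 x : Module.End ℂ 𝔤)))

/-- The choices that determine a basis of `𝔤` adapted to the grading
`𝔤 = ⨁_{m < r} 𝔤_m`, `𝔤_m = {x | ν x = ω^m x}`, `ω = e(1/r)`:
* root vectors `E_α` with `(E_α, E_{-α}) = 1`;
* representatives of the `ν̄`-orbits of roots (equivalently, of the averaged roots `α̃`), such that
  the representative of `-α̃` is minus that of `α̃`;
* bases `e^m_1, …, e^m_{n_m}` of `𝔥_m = 𝔥 ∩ 𝔤_m` with `(e^m_j, e^{r-m}_k) = δ_{jk}`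
  (and `(e^0_j, e^0_k) = δ_{jk}`); here `k` is counted from `0`. -/
structure AdaptedBasis (ν : DiagramAutomorphism H b) (r : ℕ) (c : ℂ) where
  E : LieModule.Weight ℂ H 𝔤 → 𝔤
  E_mem : ∀ α ∈ H.root, E α ∈ LieAlgebra.rootSpace H α
  E_pair : ∀ α ∈ H.root, form c (E α) (E (-α)) = 1
  reps : Finset (LieModule.Weight ℂ H 𝔤)
  reps_subset : reps ⊆ H.root
  reps_neg : ∀ α ∈ reps, -α ∈ reps
  reps_unique : ∀ α ∈ H.root, ∃! β, β ∈ reps ∧ ∃ j : ℕ, β = (ν.perm ^ j) α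
  n : ℕ → ℕ
  n_symm : ∀ m < r, n ((r - m) % r) = n m
  h : ℕ → ℕ → 𝔤
  h_mem : ∀ m < r, ∀ k < n m, h m k ∈ H ∧ ν.lin (h m k) = e (m / r) • h m k
  h_span : ∀ m < r, ∀ x ∈ H, ν.lin x = e (m / r) • x →
    x ∈ Submodule.span ℂ (h m '' {k | k < n m})
  h_pair : ∀ m < r, ∀ j < n m, ∀ k < n m,
    form c (h m j) (h ((r - m) % r) k) = if j = k then 1 else 0

namespace AdaptedBasis

variable {ν : DiagramAutomorphism H b} {r : ℕ} {c : ℂ}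

open scoped Classical in
/-- The nonzero `𝔥_0`-weights of `𝔤_m`, given by the representatives `α` of their orbits: `α` occurs
in `𝔤_m` when `ν̄ α ≠ α`, or when `ν̄ α = α` and `ν E_α = ω^m E_α`. For `m = 0` these are the roots
of `𝔤_0`. -/
def weights (B : AdaptedBasis ν r c) (m : ℕ) : Finset (LieModule.Weight ℂ H 𝔤) :=
  B.reps.filter fun α => ν.perm α ≠ α ∨ ν.lin (B.E α) = e (m / r) • B.E α

open scoped Classical in
/-- The weight vector `t^m_α` of `𝔤_m`: it is `∑_j ω^{-jm} ν^j E_α` for an orbit of length `r`,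
and `E_α` for a fixed root. -/
def vec (B : AdaptedBasis ν r c) (m : ℕ) (α : LieModule.Weight ℂ H 𝔤) : 𝔤 :=
  if ν.perm α = α then B.E α
  else ∑ j ∈ Finset.range r, e (-(j * m / r)) • (ν.lin ^ j) (B.E α)

open scoped Classical in
/-- The orbit length of `α`; it is the value of `(t^m_α, t^{r-m}_{-α})`. -/
def len (_ : AdaptedBasis ν r c) (α : LieModule.Weight ℂ H 𝔤) : ℂ :=
  if ν.perm α = α then 1 else r

end AdaptedBasis

/-! ### The Lax operator and the Hamiltonian -/

/-- The coordinates: `v k` are the momenta, `spinH m k` (for `m ≠ 0`) and `spinR m α` are the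
coordinates of the residue `S` in the basis `e^m_k`, `t^m_α`. The part of `S` in `𝔥_0` is zero by the
moment constraint, so it has no coordinates. -/
structure PhasePoint (H : LieSubalgebra ℂ 𝔤) [H.IsCartanSubalgebra] where
  v : ℕ → ℂ
  spinH : ℕ → ℕ → ℂ
  spinR : ℕ → LieModule.Weight ℂ H 𝔤 → ℂ

variable {ν : DiagramAutomorphism H b} {r : ℕ} {c : ℂ}

/-- The component `S_m ∈ 𝔤_m` of the residue. -/
def residueComponent (B : AdaptedBasis ν r c) (p : PhasePoint H) (m : ℕ) : 𝔤 :=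
  (if m = 0 then 0 else ∑ k ∈ Finset.range (B.n m), p.spinH m k • B.h m k) +
    ∑ α ∈ B.weights m, p.spinR m α • B.vec m α

/-- The residue `S = ∑_m S_m`. -/
def residue (B : AdaptedBasis ν r c) (p : PhasePoint H) : 𝔤 :=
  ∑ m ∈ Finset.range r, residueComponent B p m

/-- The component `L_m ∈ 𝔤_m` of the Lax operator at the point `x` of `𝔥`:
`L_0 = ∑ v_k e^0_k + ∑ S_0^α g(-α̃(x), z) E_α̃`, and
`L_m = ∑ S^m_k g^{(-m)}(0, z) e^m_k + ∑ S_m^α g^{(-m)}(-α̃(x), z) t^m_α` for `m ≠ 0`. -/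
def laxComponent (B : AdaptedBasis ν r c) (τ : ℂ) (x : H) (p : PhasePoint H) (m : ℕ) (z : ℂ) : 𝔤 :=
  (if m = 0 then ∑ k ∈ Finset.range (B.n 0), p.v k • B.h 0 k
    else ∑ k ∈ Finset.range (B.n m), (p.spinH m k * kroneckerTwist τ r (-m) 0 z) • B.h m k) +
  ∑ α ∈ B.weights m,
    (p.spinR m α * kroneckerTwist τ r (-m) (-avgRoot ν r α x) z) • B.vec m α

/-- The Lax operator `L = ∑_m L_m`. -/
def lax (B : AdaptedBasis ν r c) (τ : ℂ) (x : H) (p : PhasePoint H) (z : ℂ) : 𝔤 :=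
  ∑ m ∈ Finset.range r, laxComponent B τ x p m z

/-- `H_0 = ½ ∑ v_k² - ½ ∑_α ℓ_α S_0^α S_0^{-α} E₂(α̃(x))`. -/
def hamZero (B : AdaptedBasis ν r c) (τ : ℂ) (x : H) (p : PhasePoint H) : ℂ :=
  (1 / 2) * ∑ k ∈ Finset.range (B.n 0), p.v k ^ 2 -
    (1 / 2) * ∑ α ∈ B.weights 0,
      B.len α * p.spinR 0 α * p.spinR 0 (-α) * eisensteinTwo τ (avgRoot ν r α x)

/-- `H' = ∑_{m ≠ 0} (-½ ∑_k S^m_k S^{r-m}_k E₂(mτ/r)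
  - ½ ∑_α ℓ_α S_{r-m}^α S_m^{-α} E₂(α̃(x) - mτ/r))`. -/
def hamPrime (B : AdaptedBasis ν r c) (τ : ℂ) (x : H) (p : PhasePoint H) : ℂ :=
  ∑ m ∈ Finset.Ico 1 r,
    (-(1 / 2) * ∑ k ∈ Finset.range (B.n m),
        p.spinH m k * p.spinH (r - m) k * eisensteinTwo τ (m * τ / r) -
      (1 / 2) * ∑ α ∈ B.weights (r - m),
        B.len α * p.spinR (r - m) α * p.spinR m (-α) *
          eisensteinTwo τ (avgRoot ν r α x - m * τ / r))

/-- The second Casimir function `C₂ = ½ (S, S)`. -/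
def casimir (B : AdaptedBasis ν r c) (p : PhasePoint H) : ℂ :=
  (1 / 2) * form c (residue B p) (residue B p)

/-- `x` is regular: no coefficient function of the Lax operator at `x` is singular. -/
def IsRegular (B : AdaptedBasis ν r c) (τ : ℂ) (x : H) : Prop :=
  ∀ m < r, ∀ α ∈ B.weights m, avgRoot ν r α x + m * τ / r ∉ periodLattice τ

end Lie

end TwistedCM

end

/-! Both quasi-periodicities and the residue can be read off coefficient by coefficient. The
prefactor `e(mz/r)` in the twisted Kronecker function is chosen so that `g^{(-m)}(w,z)` picks up
`ω^m` under `z ↦ z - 1` and `e(-w)` under `z ↦ z + τ`, and its pole at `0` has residue `1`. The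
first multiplier is the eigenvalue of `ν` on `𝔤_m`. For `w = -α̃(x)` the second is `e(α̃(x))`, the
eigenvalue of `Ad` of `e(u + ϖ̄)` on the weight vector `t^m_α`, because a root evaluated at the
invariant part of `x` equals the averaged root evaluated at `x` (`apply_invariantPart`).

The quadratic identity has an algebraic and an analytic half. Algebraically, invariance of the form
under `ν` leaves only the pairings of degree `m` with degree `-m` (`form_sum_sum_of_lin_eq`), and
there the adapted bases are dual up to orbit lengths (`form_combination`). So `(L, L)` is a sum of
products of the coefficient at `(m, α)` with the one at `(-m, -α)`, together with Cartan products.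

Analytically, each such product of Kronecker functions is `φ(w,z) φ(-w,z) = E₂(z) - E₂(w)`, after
the exponential prefactors cancel against a shift by `τ` (`kroneckerTwist_mul`). The term `E₂(z)`
collects the Casimir and `-E₂(w)` collects the Hamiltonian. The product formula is the classical
factorisation of `℘(z) - ℘(w)`, obtained from Liouville's theorem in
`eisensteinTwo_sub_eisensteinTwo`; it rests on the theta function being entire, odd, quasi-periodic,
and zero exactly on the lattice, with a simple zero at `0`. -/

namespace TwistedCM

/-! ### The theta function -/

section Theta

open Complex

lemma e_add (z w : ℂ) : e (z + w) = e z * e w := by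
  rw [e, e, e, ← Complex.exp_add]; ring_nf

lemma e_zero : e 0 = 1 := by simp [e]

lemma e_ne_zero (z : ℂ) : e z ≠ 0 := Complex.exp_ne_zero _

lemma e_neg (z : ℂ) : e (-z) = (e z)⁻¹ := by
  rw [e, e, ← Complex.exp_neg]; ring_nf

lemma e_one : e 1 = 1 := by simp [e, Complex.exp_two_pi_mul_I]

lemma e_natMul (n : ℕ) (z : ℂ) : e (n * z) = e z ^ n := by
  rw [e, e, ← Complex.exp_nat_mul]; ring_nf

lemma e_eq_one_iff {z : ℂ} : e z = 1 ↔ ∃ n : ℤ, z = n := by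
  rw [e, Complex.exp_eq_one_iff]
  refine exists_congr fun n => ⟨fun h => ?_, fun h => by rw [h]; ring⟩
  have hne := Complex.two_pi_I_ne_zero
  refine mul_left_cancel₀ hne ?_
  rw [h]; ring

lemma e_intCast (n : ℤ) : e n = 1 := e_eq_one_iff.2 ⟨n, rfl⟩

lemma norm_e (z : ℂ) : ‖e z‖ = Real.exp (-(2 * Real.pi * z.im)) := by
  rw [e, Complex.norm_exp]
  simp

lemma differentiable_e : Differentiable ℂ e := by
  unfold e; fun_prop

lemma sin_pi_eq (z : ℂ) :
    Complex.sin (Real.pi * z) = I / 2 * (e (-z / 2) * (1 - e z)) := by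
  rw [Complex.sin, mul_sub, mul_one, ← e_add, e, e]
  ring_nf

lemma periodLattice_zero (τ : ℂ) : (0 : ℂ) ∈ periodLattice τ := ⟨0, 0, by simp⟩

lemma periodLattice_neg {τ z : ℂ} (h : z ∈ periodLattice τ) : -z ∈ periodLattice τ := by
  obtain ⟨a, b, rfl⟩ := h
  exact ⟨-a, -b, by push_cast; ring⟩

lemma neg_mem_periodLattice {τ z : ℂ} : -z ∈ periodLattice τ ↔ z ∈ periodLattice τ :=
  ⟨fun h => by simpa using periodLattice_neg h, periodLattice_neg⟩

lemma add_int_mem_periodLattice {τ z : ℂ} (a b : ℤ) :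
    z + (a + b * τ) ∈ periodLattice τ ↔ z ∈ periodLattice τ := by
  constructor
  · rintro ⟨c, d, h⟩
    exact ⟨c - a, d - b, by push_cast; linear_combination h⟩
  · rintro ⟨c, d, rfl⟩
    exact ⟨c + a, d + b, by push_cast; ring⟩

/-- The `q`-Pochhammer product `∏_{n ≥ 1} (1 - qⁿ t)`, `q = e(τ)`. -/
noncomputable def qProd (τ t : ℂ) : ℂ := ∏' n : ℕ, (1 - e ((n + 1) * τ) * t)

variable {τ : ℂ}

lemma summable_norm_e (hτ : 0 < τ.im) : Summable fun n : ℕ => ‖e ((n + 1) * τ)‖ := by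
  have h : ∀ n : ℕ, ‖e ((n + 1) * τ)‖ = ‖e τ‖ ^ (n + 1) := fun n => by
    rw [← norm_pow, ← e_natMul]; push_cast; rfl
  simp_rw [h]
  refine (summable_nat_add_iff 1).2 (summable_geometric_of_lt_one (norm_nonneg _) ?_)
  rw [norm_e, Real.exp_lt_one_iff]
  have := Real.pi_pos
  simp only [Left.neg_neg_iff]
  positivity

lemma summable_norm_qProd (hτ : 0 < τ.im) (t : ℂ) :
    Summable fun n : ℕ => ‖-(e ((n + 1) * τ) * t)‖ := by
  simpa [norm_mul] using (summable_norm_e hτ).mul_right ‖t‖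

lemma multipliable_qProd (hτ : 0 < τ.im) (t : ℂ) :
    Multipliable fun n : ℕ => 1 - e ((n + 1) * τ) * t := by
  simpa [sub_eq_add_neg] using multipliable_one_add_of_summable (summable_norm_qProd hτ t)

lemma qProd_ne_zero (hτ : 0 < τ.im) {t : ℂ} (h : ∀ n : ℕ, e ((n + 1) * τ) * t ≠ 1) :
    qProd τ t ≠ 0 := by
  have := tprod_one_add_ne_zero_of_summable (f := fun n : ℕ => -(e ((n + 1) * τ) * t))
    (fun n => by rw [← sub_eq_add_neg]; exact sub_ne_zero.2 (h n).symm)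
    (summable_norm_qProd hτ t)
  simpa [qProd, sub_eq_add_neg] using this

lemma qProd_eq (hτ : 0 < τ.im) (t : ℂ) :
    qProd τ t = (1 - e τ * t) * qProd τ (e τ * t) := by
  have hs : ∀ n : ℕ, 1 - e ((((n + 1 : ℕ) : ℂ) + 1) * τ) * t =
      1 - e ((n + 1) * τ) * (e τ * t) := by
    intro n
    rw [← mul_assoc, ← e_add]
    push_cast
    ring_nf
  have hm : Multipliable fun n : ℕ => 1 - e ((((n + 1 : ℕ) : ℂ) + 1) * τ) * t :=
    (multipliable_qProd hτ (e τ * t)).congr fun n => (hs n).symm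
  have h := tprod_eq_zero_mul' (f := fun n : ℕ => 1 - e (((n : ℂ) + 1) * τ) * t) hm
  rw [qProd, h, tprod_congr hs, qProd]
  simp only [Nat.cast_zero, zero_add, one_mul]

lemma differentiable_qProd (hτ : 0 < τ.im) : Differentiable ℂ (qProd τ) := by
  intro t₀
  have hR : (0 : ℝ) < ‖t₀‖ + 1 := by positivity
  -- A ball about `0` containing `t₀` gives the summable majorant `‖qⁿ‖ (‖t₀‖ + 1)`, hence a locally
  -- uniform limit of polynomials in `t`.
  have h := Summable.hasProdLocallyUniformlyOn_nat_one_add (R := ℂ)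
    (K := Metric.ball (0 : ℂ) (‖t₀‖ + 1)) (f := fun n t => -(e (((n : ℕ) + 1) * τ) * t))
    Metric.isOpen_ball ((summable_norm_e hτ).mul_right (‖t₀‖ + 1))
    (Filter.Eventually.of_forall fun n t ht => by
      rw [norm_neg, norm_mul]
      gcongr
      simpa using (Metric.mem_ball.1 ht).le) (fun n => by fun_prop)
  have hd := h.differentiableOn
    (.of_forall fun _ => by
      simpa [Finset.prod_fn] using DifferentiableOn.finsetProd (fun _ _ => by fun_prop))
    Metric.isOpen_ball
  have := hd.differentiableAt (Metric.isOpen_ball.mem_nhds (by simp : t₀ ∈ _))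
  simpa [qProd, sub_eq_add_neg] using! this

lemma theta_eq (hτ : 0 < τ.im) (z : ℂ) :
    theta τ z = Complex.sin (Real.pi * z) * (2 * Complex.exp (Real.pi * Complex.I * τ / 4) *
      (qProd τ 1 * qProd τ (e z) * qProd τ (e (-z)))) := by
  have h1 := multipliable_qProd hτ 1
  rw [theta, qProd, qProd, qProd, ← h1.tprod_mul (multipliable_qProd hτ _),
    ← (h1.mul (multipliable_qProd hτ _)).tprod_mul (multipliable_qProd hτ _)]
  simp only [mul_one]
  ring

lemma theta_neg (hτ : 0 < τ.im) (z : ℂ) : theta τ (-z) = - theta τ z := by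
  rw [theta_eq hτ, theta_eq hτ, mul_neg, Complex.sin_neg, neg_neg]
  ring

lemma theta_zero (τ : ℂ) : theta τ 0 = 0 := by simp [theta]

lemma theta_add_one (hτ : 0 < τ.im) (z : ℂ) : theta τ (z + 1) = - theta τ z := by
  rw [theta_eq hτ, theta_eq hτ, mul_add, mul_one, Complex.sin_add_pi, neg_add, e_add, e_add,
    e_neg 1, e_one]
  simp

/-- The shift takes the first factor out of one Pochhammer product and adds a factor `1 - e(-z)` to
the other; together with the factor `1 - e(z)` of the sine these leave only an exponential. -/
lemma theta_add_tau (hτ : 0 < τ.im) (z : ℂ) :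
    theta τ (z + τ) = - (e (-τ / 2) * e (-z)) * theta τ z := by
  rw [theta_eq hτ, theta_eq hτ, sin_pi_eq, sin_pi_eq]
  have h1 : qProd τ (e z) = (1 - e (z + τ)) * qProd τ (e (z + τ)) := by
    rw [qProd_eq hτ (e z), e_add, mul_comm (e z)]
  have h2 : qProd τ (e (-(z + τ))) = (1 - e (-z)) * qProd τ (e (-z)) := by
    rw [qProd_eq hτ (e (-(z + τ))), ← e_add]; ring_nf
  have h3 : e (-(z + τ) / 2) = e (-τ / 2) * e (-z / 2) := by rw [← e_add]; ring_nf
  have h4 : e (-z) * e z = 1 := by rw [← e_add]; simp [e_zero]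
  rw [h1, h2, h3]
  linear_combination (-(I / 2 * (e (-τ / 2) * e (-z / 2)) * (1 - e (z + τ)) *
    (2 * Complex.exp (Real.pi * Complex.I * τ / 4) *
      (qProd τ 1 * qProd τ (e (z + τ)) * qProd τ (e (-z)))))) * h4

lemma differentiable_theta (hτ : 0 < τ.im) : Differentiable ℂ (theta τ) := by
  have h1 : Differentiable ℂ fun z => qProd τ (e z) :=
    (differentiable_qProd hτ).comp differentiable_e
  have h2 : Differentiable ℂ fun z => qProd τ (e (-z)) := h1.comp differentiable_neg
  rw [funext (theta_eq hτ)]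
  fun_prop

lemma e_mul_e_ne_one {z : ℂ} (hz : z ∉ periodLattice τ) (n : ℕ) :
    e ((n + 1) * τ) * e z ≠ 1 := by
  rw [← e_add]
  intro h
  obtain ⟨k, hk⟩ := e_eq_one_iff.1 h
  exact hz ⟨k, -(n + 1), by push_cast; linear_combination hk⟩

lemma e_ne_one (hτ : 0 < τ.im) (n : ℕ) : e ((n + 1) * τ) * 1 ≠ 1 := by
  rw [mul_one]
  intro h
  obtain ⟨k, hk⟩ := e_eq_one_iff.1 h
  have := congrArg Complex.im hk
  simp at this
  rcases this with h | h
  · norm_cast at h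
  · exact hτ.ne' h

lemma theta_ne_zero (hτ : 0 < τ.im) {z : ℂ} (hz : z ∉ periodLattice τ) : theta τ z ≠ 0 := by
  rw [theta_eq hτ]
  have hz' : -z ∉ periodLattice τ := fun h => hz (neg_mem_periodLattice.1 h)
  have hs : Complex.sin (Real.pi * z) ≠ 0 := by
    rw [sin_pi_eq]
    refine mul_ne_zero (by simp) (mul_ne_zero (e_ne_zero _) (sub_ne_zero.2 fun h => hz ?_))
    obtain ⟨k, hk⟩ := e_eq_one_iff.1 h.symm
    exact ⟨k, 0, by simp [hk]⟩
  refine mul_ne_zero hs (mul_ne_zero (mul_ne_zero two_ne_zero (Complex.exp_ne_zero _))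
    (mul_ne_zero (mul_ne_zero ?_ ?_) ?_))
  · exact qProd_ne_zero hτ (e_ne_one hτ)
  · exact qProd_ne_zero hτ (e_mul_e_ne_one hz)
  · exact qProd_ne_zero hτ (e_mul_e_ne_one hz')

/-- Only the sine vanishes at `0`, so the derivative is `π` times a non-zero cofactor. -/
lemma deriv_theta_zero_ne_zero (hτ : 0 < τ.im) : deriv (theta τ) 0 ≠ 0 := by
  have h1 : Differentiable ℂ fun z => qProd τ (e z) :=
    (differentiable_qProd hτ).comp differentiable_e
  have h2 : Differentiable ℂ fun z => qProd τ (e (-z)) := h1.comp differentiable_neg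
  have hs : HasDerivAt (fun z : ℂ => Complex.sin (Real.pi * z)) Real.pi 0 := by
    have := (Complex.hasDerivAt_sin ((Real.pi : ℂ) * 0)).comp (0 : ℂ)
      ((hasDerivAt_id (0 : ℂ)).const_mul (Real.pi : ℂ))
    simpa [Function.comp_def] using this
  have hg : DifferentiableAt ℂ (fun z => 2 * Complex.exp (Real.pi * Complex.I * τ / 4) *
      (qProd τ 1 * qProd τ (e z) * qProd τ (e (-z)))) 0 := by fun_prop
  have h := hs.mul hg.hasDerivAt
  rw [funext (theta_eq hτ)]
  have h' := h.deriv
  simp only [mul_zero, Complex.sin_zero, zero_mul, add_zero, neg_zero, e_zero] at h'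
  erw [h']
  have hq := qProd_ne_zero hτ (e_ne_one hτ)
  refine mul_ne_zero (by simp [Real.pi_ne_zero]) (mul_ne_zero (mul_ne_zero two_ne_zero
    (Complex.exp_ne_zero _)) (mul_ne_zero (mul_ne_zero hq hq) hq))

lemma theta_sub_tau (hτ : 0 < τ.im) (z : ℂ) : theta τ (z - τ) =
    - (e (-τ / 2) * e z) * theta τ z := by
  rw [← neg_neg (z - τ), theta_neg hτ, neg_sub, sub_eq_neg_add, theta_add_tau hτ, neg_neg,
    theta_neg hτ]
  ring

lemma theta_lattice (hτ : 0 < τ.im) {z : ℂ} (hz : z ∈ periodLattice τ) : theta τ z = 0 := by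
  have h1 : ∀ w, theta τ w = 0 → ∀ b : ℤ, theta τ (w + b * τ) = 0 := by
    intro w hw b
    induction b using Int.induction_on with
    | zero => simpa using hw
    | succ n ih =>
      push_cast at ih ⊢
      rw [show w + ((n : ℂ) + 1) * τ = w + n * τ + τ by ring, theta_add_tau hτ, ih, mul_zero]
    | pred n ih =>
      push_cast at ih ⊢
      rw [show w + (-(n : ℂ) - 1) * τ = w + -n * τ - τ by ring, theta_sub_tau hτ, ih,
        mul_zero]
  obtain ⟨a, b, rfl⟩ := hz
  refine h1 _ ?_ b
  have : Complex.sin (Real.pi * a) = 0 := by rw [mul_comm, Complex.sin_int_mul_pi]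
  rw [theta_eq hτ, this, zero_mul]

lemma theta_eq_zero_iff (hτ : 0 < τ.im) {z : ℂ} : theta τ z = 0 ↔ z ∈ periodLattice τ :=
  ⟨fun h => by_contra fun hz => theta_ne_zero hτ hz h, theta_lattice hτ⟩

end Theta

/-! ### The Kronecker function -/

section Kronecker

open Complex Filter

variable {τ : ℂ}

/-! ### Discreteness of the lattice and Liouville's theorem for elliptic functions. -/

lemma isOpen_compl_periodLattice (hτ : 0 < τ.im) : IsOpen (periodLattice τ)ᶜ := by
  have : (periodLattice τ)ᶜ = {z | theta τ z ≠ 0} := by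
    ext z; simp [theta_eq_zero_iff hτ]
  rw [this]
  exact isOpen_ne_fun (differentiable_theta hτ).continuous continuous_const

lemma eventually_notMem_periodLattice (hτ : 0 < τ.im) {z : ℂ} (hz : z ∉ periodLattice τ) :
    ∀ᶠ w in 𝓝 z, w ∉ periodLattice τ :=
  (isOpen_compl_periodLattice hτ).mem_nhds hz

/-- The slope is the entire extension of `θ(z)/z`, with value `θ'(0)` at `0`; it makes the
cancellation of poles at `0` explicit. -/
lemma theta_eq_mul_dslope (τ z : ℂ) : theta τ z = z * dslope (theta τ) 0 z := by
  have := sub_smul_dslope (theta τ) 0 z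
  simpa [theta_zero] using this.symm

lemma differentiable_dslope {f : ℂ → ℂ} (hf : Differentiable ℂ f) (c : ℂ) :
    Differentiable ℂ (dslope f c) := by
  rw [← differentiableOn_univ] at hf ⊢
  exact (Complex.differentiableOn_dslope univ_mem).2 hf

lemma eventually_nhdsNE_zero_notMem_periodLattice (hτ : 0 < τ.im) :
    ∀ᶠ w in 𝓝[≠] (0 : ℂ), w ∉ periodLattice τ := by
  have hc := (differentiable_dslope (differentiable_theta hτ) 0).continuous.continuousAt (x := 0)
  have h0 : dslope (theta τ) 0 0 ≠ 0 := by
    rw [dslope_same]; exact deriv_theta_zero_ne_zero hτ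
  filter_upwards [(hc.eventually_ne h0).filter_mono nhdsWithin_le_nhds, self_mem_nhdsWithin]
    with w hw hw0
  rw [← theta_eq_zero_iff hτ, theta_eq_mul_dslope]
  exact mul_ne_zero hw0 hw

/-- A doubly periodic function whose singularities on the lattice are removable is constant. -/
lemma eq_of_periodic_of_removable (hτ : 0 < τ.im) {h g : ℂ → ℂ}
    (hd : ∀ z ∉ periodLattice τ, DifferentiableAt ℂ h z)
    (h1 : ∀ z ∉ periodLattice τ, h (z + 1) = h z) (h2 : ∀ z ∉ periodLattice τ, h (z + τ) = h z)
    (hg : DifferentiableAt ℂ g 0) (hhg : ∀ᶠ z in 𝓝[≠] 0, h z = g z)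
    {z w : ℂ} (hz : z ∉ periodLattice τ) (hw : w ∉ periodLattice τ) : h z = h w := by
  classical
  -- One value fills every puncture, so the extension stays doubly periodic and its
  -- differentiability on the lattice reduces to the point `0`.
  let f : ℂ → ℂ := fun z => if z ∈ periodLattice τ then g 0 else h z
  have hf : ∀ z, z ∉ periodLattice τ → f z = h z := fun z hz => if_neg hz
  have hf1 : Function.Periodic f 1 := by
    intro z
    have := add_int_mem_periodLattice (τ := τ) (z := z) 1 0
    simp only [Int.cast_one, Int.cast_zero, zero_mul, add_zero] at this
    by_cases hz : z ∈ periodLattice τ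
    · simp only [f, if_pos hz, if_pos (this.2 hz)]
    · simp only [f, if_neg hz, if_neg (fun h => hz (this.1 h)), h1 z hz]
  have hf2 : Function.Periodic f τ := by
    intro z
    have := add_int_mem_periodLattice (τ := τ) (z := z) 0 1
    simp only [Int.cast_one, Int.cast_zero, one_mul, zero_add] at this
    by_cases hz : z ∈ periodLattice τ
    · simp only [f, if_pos hz, if_pos (this.2 hz)]
    · simp only [f, if_neg hz, if_neg (fun h => hz (this.1 h)), h2 z hz]
  have hper : ∀ (a b : ℤ) (z : ℂ), f (z + (a + b * τ)) = f z := fun a b z => by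
    rw [← add_assoc, hf2.int_mul b, ← mul_one (a : ℂ), hf1.int_mul a]
  have hf0 : DifferentiableAt ℂ f 0 := by
    refine hg.congr_of_eventuallyEq ?_
    rw [eventuallyEq_iff_exists_mem]
    have := hhg.and (eventually_nhdsNE_zero_notMem_periodLattice hτ)
    rw [eventually_nhdsWithin_iff] at this
    refine ⟨_, this, fun z hz => ?_⟩
    by_cases hz0 : z = 0
    · simp [f, hz0, periodLattice_zero]
    · obtain ⟨hz1, hz2⟩ := hz hz0
      simp [f, hz2, hz1]
  have hfd : Differentiable ℂ f := by
    intro z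
    by_cases hz : z ∈ periodLattice τ
    · obtain ⟨a, b, rfl⟩ := hz
      have : f = fun w => f (w + -(a + b * τ)) := by
        funext w
        rw [← hper a b (w + -(a + b * τ)), neg_add_cancel_right]
      rw [this]
      refine DifferentiableAt.comp (g := f) _ ?_ (by fun_prop)
      simpa using hf0
    · refine (hd z hz).congr_of_eventuallyEq ?_
      filter_upwards [eventually_notMem_periodLattice hτ hz] with w hw using hf w hw
  have hb : Bornology.IsBounded (Set.range f) := by
    have hK : IsCompact ((fun p : ℝ × ℝ => f (p.1 + p.2 * τ)) ''
        (Set.Icc 0 1 ×ˢ Set.Icc 0 1)) := by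
      refine (isCompact_Icc.prod isCompact_Icc).image ?_
      exact hfd.continuous.comp (by fun_prop)
    refine hK.isBounded.subset ?_
    rintro _ ⟨z, rfl⟩
    -- The real coordinates of `z` in the basis `1, τ`; their fractional parts move `z` into the
    -- compact fundamental parallelogram.
    let t : ℝ := z.im / τ.im
    let s : ℝ := z.re - t * τ.re
    have hzst : z = s + t * τ := by
      apply Complex.ext
      · simp [s]
      · simp [t, hτ.ne']
    refine ⟨(Int.fract s, Int.fract t), ⟨⟨Int.fract_nonneg s, (Int.fract_lt_one s).le⟩,
      Int.fract_nonneg t, (Int.fract_lt_one t).le⟩, ?_⟩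
    simp only
    rw [← hper ⌊s⌋ ⌊t⌋, hzst]
    congr 1
    have e1 : (s : ℂ) = ⌊s⌋ + Int.fract s := by exact_mod_cast (Int.floor_add_fract s).symm
    have e2 : (t : ℂ) = ⌊t⌋ + Int.fract t := by exact_mod_cast (Int.floor_add_fract t).symm
    linear_combination -e1 - τ * e2
  rw [← hf z hz, ← hf w hw]
  exact hfd.apply_eq_apply_of_bounded hb z w

/-! ### The Eisenstein functions. -/

lemma differentiable_deriv {f : ℂ → ℂ} (hf : Differentiable ℂ f) : Differentiable ℂ (deriv f) := by
  rw [← differentiableOn_univ] at hf ⊢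
  exact hf.deriv isOpen_univ

lemma differentiableAt_eisensteinOne (hτ : 0 < τ.im) {z : ℂ} (hz : z ∉ periodLattice τ) :
    DifferentiableAt ℂ (eisensteinOne τ) z := by
  have h1 := differentiable_theta hτ
  have h2 := differentiable_deriv h1
  have : eisensteinOne τ = fun z => deriv (theta τ) z / theta τ z := by
    funext z; rw [eisensteinOne, logDeriv_apply]
  rw [this]
  exact (h2 z).div (h1 z) (theta_ne_zero hτ hz)

lemma differentiableAt_eisensteinTwo (hτ : 0 < τ.im) {z : ℂ} (hz : z ∉ periodLattice τ) :
    DifferentiableAt ℂ (eisensteinTwo τ) z := by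
  have h : DifferentiableOn ℂ (eisensteinOne τ) (periodLattice τ)ᶜ := fun z hz =>
    (differentiableAt_eisensteinOne hτ hz).differentiableWithinAt
  exact ((h.deriv (isOpen_compl_periodLattice hτ)).differentiableAt
    ((isOpen_compl_periodLattice hτ).mem_nhds hz)).neg

lemma eisensteinTwo_eq (hτ : 0 < τ.im) {z : ℂ} (hz : z ∉ periodLattice τ) :
    eisensteinTwo τ z = (deriv (theta τ) z ^ 2 - theta τ z * deriv (deriv (theta τ)) z) /
      theta τ z ^ 2 := by
  have h1 := differentiable_theta hτ
  have h2 := differentiable_deriv h1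
  have : eisensteinOne τ = fun z => deriv (theta τ) z / theta τ z := by
    funext z; rw [eisensteinOne, logDeriv_apply]
  rw [eisensteinTwo, this, deriv_fun_div (h2 z) (h1 z) (theta_ne_zero hτ hz)]
  ring

lemma eisensteinOne_add_one (hτ : 0 < τ.im) (z : ℂ) :
    eisensteinOne τ (z + 1) = eisensteinOne τ z := by
  have h : (fun w => theta τ (w + 1)) = fun w => - theta τ w := funext (theta_add_one hτ)
  have := congrArg (fun f => deriv f z) h
  simp only [deriv_comp_add_const, deriv.fun_neg] at this
  rw [eisensteinOne, eisensteinOne, logDeriv_apply, logDeriv_apply, this, theta_add_one hτ, neg_div_neg_eq]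

lemma hasDerivAt_e (z : ℂ) : HasDerivAt e (2 * Real.pi * I * e z) z := by
  have := ((hasDerivAt_id z).const_mul (2 * Real.pi * I : ℂ)).cexp
  simp only [id, mul_one] at this
  rw [mul_comm]
  exact this

/-- The logarithmic derivative turns the theta multiplier into an additive constant, which
disappears in `E₂`. -/
lemma eisensteinOne_add_tau (hτ : 0 < τ.im) {z : ℂ} (hz : z ∉ periodLattice τ) :
    eisensteinOne τ (z + τ) = eisensteinOne τ z - 2 * Real.pi * I := by
  have h : (fun w => theta τ (w + τ)) = fun w => - (e (-τ / 2) * e (-w)) * theta τ w :=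
    funext (theta_add_tau hτ)
  have := congrArg (fun f => deriv f z) h
  have hd : HasDerivAt (fun w => - (e (-τ / 2) * e (-w)) * theta τ w)
      (- (e (-τ / 2) * (2 * Real.pi * I * e (-z) * -1)) * theta τ z +
        - (e (-τ / 2) * e (-z)) * deriv (theta τ) z) z :=
    ((((hasDerivAt_e (-z)).comp z (hasDerivAt_neg z)).const_mul _).neg).mul
      (differentiable_theta hτ z).hasDerivAt
  simp only [deriv_comp_add_const] at this
  rw [hd.deriv] at this
  have ht := theta_ne_zero hτ hz
  have he := e_ne_zero (-τ / 2)
  have he' := e_ne_zero (-z)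
  rw [eisensteinOne, eisensteinOne, logDeriv_apply, logDeriv_apply, this, theta_add_tau hτ]
  generalize e (-τ / 2) = a at *
  field_simp
  ring

lemma eisensteinTwo_add_one (hτ : 0 < τ.im) (z : ℂ) :
    eisensteinTwo τ (z + 1) = eisensteinTwo τ z := by
  have h : (fun w => eisensteinOne τ (w + 1)) = eisensteinOne τ :=
    funext (eisensteinOne_add_one hτ)
  rw [eisensteinTwo, eisensteinTwo, ← deriv_comp_add_const, h]

lemma eisensteinTwo_add_tau (hτ : 0 < τ.im) {z : ℂ} (hz : z ∉ periodLattice τ) :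
    eisensteinTwo τ (z + τ) = eisensteinTwo τ z := by
  have h : (fun w => eisensteinOne τ (w + τ)) =ᶠ[𝓝 z]
      fun w => eisensteinOne τ w - 2 * Real.pi * I := by
    filter_upwards [eventually_notMem_periodLattice hτ hz] with w hw
      using eisensteinOne_add_tau hτ hw
  rw [eisensteinTwo, eisensteinTwo, ← deriv_comp_add_const, h.deriv_eq, deriv_sub_const]

lemma deriv_theta_neg (hτ : 0 < τ.im) (z : ℂ) : deriv (theta τ) (-z) = deriv (theta τ) z := by
  have h : (fun w => theta τ (-w)) = fun w => - theta τ w := funext (theta_neg hτ)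
  have := congrArg (fun f => deriv f z) h
  simp only [deriv_comp_neg, deriv.fun_neg, neg_inj] at this
  exact this

lemma deriv_deriv_theta_neg (hτ : 0 < τ.im) (z : ℂ) :
    deriv (deriv (theta τ)) (-z) = - deriv (deriv (theta τ)) z := by
  have h : (fun w => deriv (theta τ) (-w)) = deriv (theta τ) := funext (deriv_theta_neg hτ)
  have := congrArg (fun f => deriv f z) h
  simp only [deriv_comp_neg] at this
  rw [← this, neg_neg]

lemma eisensteinTwo_neg (hτ : 0 < τ.im) {z : ℂ} (hz : z ∉ periodLattice τ) :
    eisensteinTwo τ (-z) = eisensteinTwo τ z := by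
  rw [eisensteinTwo_eq hτ hz, eisensteinTwo_eq hτ (fun h => hz (neg_mem_periodLattice.1 h)),
    deriv_deriv_theta_neg hτ, deriv_theta_neg hτ, theta_neg hτ]
  ring

/-- The difference of the two sides is elliptic in `z`, its double pole at `0` cancels, and it
vanishes at `z = u`; hence it is identically zero off the lattice. -/
lemma eisensteinTwo_sub_eisensteinTwo (hτ : 0 < τ.im) {u z : ℂ} (hu : u ∉ periodLattice τ)
    (hz : z ∉ periodLattice τ) :
    eisensteinTwo τ z - eisensteinTwo τ u =
      -(deriv (theta τ) 0 ^ 2 / theta τ u ^ 2 * (theta τ (z + u) * theta τ (z - u)) /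
        theta τ z ^ 2) := by
  have hd := differentiable_theta hτ
  have hd' := differentiable_deriv hd
  have hd'' := differentiable_deriv hd'
  have hu0 := theta_ne_zero hτ hu
  set k := deriv (theta τ) 0 ^ 2 / theta τ u ^ 2 with hk
  let h : ℂ → ℂ := fun z => eisensteinTwo τ z - eisensteinTwo τ u +
    k * (theta τ (z + u) * theta τ (z - u)) / theta τ z ^ 2
  -- The numerator of `h` over `θ²`. The constant `k` makes it vanish at `0`, and evenness then
  -- makes that zero at least double, enough to cancel the zero of `θ²`.
  let F : ℂ → ℂ := fun z => deriv (theta τ) z ^ 2 - theta τ z * deriv (deriv (theta τ)) z -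
    eisensteinTwo τ u * theta τ z ^ 2 + k * (theta τ (z + u) * theta τ (z - u))
  have hF : Differentiable ℂ F := by
    have h1 : Differentiable ℂ fun z => theta τ (z + u) := hd.comp (by fun_prop)
    have h2 : Differentiable ℂ fun z => theta τ (z - u) := hd.comp (by fun_prop)
    fun_prop
  have hF0 : F 0 = 0 := by
    have : deriv (theta τ) 0 ^ 2 = k * theta τ u ^ 2 := by
      rw [hk]; field_simp
    simp only [F, theta_zero, zero_add, zero_sub, theta_neg hτ]
    linear_combination this
  have hFneg : (fun z => F (-z)) = F := by
    funext z
    simp only [F, deriv_theta_neg hτ, deriv_deriv_theta_neg hτ, theta_neg hτ]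
    rw [show -z + u = -(z - u) by ring, show -z - u = -(z + u) by ring, theta_neg hτ,
      theta_neg hτ]
    ring
  have hF1 : deriv F 0 = 0 := by
    have := congrArg (fun f => deriv f 0) hFneg
    simp only [deriv_comp_neg, neg_zero] at this
    linear_combination (-1 / 2) * this
  have hFG : ∀ w, F w = w * (w * dslope (dslope F 0) 0 w) := by
    intro w
    have h1 := sub_smul_dslope F 0 w
    have h2 := sub_smul_dslope (dslope F 0) 0 w
    simp only [sub_zero, smul_eq_mul, dslope_same, hF1, hF0] at h1 h2
    rw [h2, h1]
  have hhF : ∀ w ∉ periodLattice τ, h w = F w / theta τ w ^ 2 := by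
    intro w hw
    have := theta_ne_zero hτ hw
    simp only [h, F]
    rw [eisensteinTwo_eq hτ hw]
    field_simp
  have hdt := differentiable_dslope hd 0
  have hdF := differentiable_dslope (differentiable_dslope hF 0) 0
  have key := eq_of_periodic_of_removable hτ (h := h)
    (g := fun w => dslope (dslope F 0) 0 w / dslope (theta τ) 0 w ^ 2) ?_ ?_ ?_ ?_ ?_ hz hu
  · have h0 : h u = 0 := by simp [h, theta_zero]
    rw [h0] at key
    simp only [h] at key
    linear_combination key
  · intro w hw
    have := theta_ne_zero hτ hw
    have h1 : Differentiable ℂ fun z => theta τ (z + u) := hd.comp (by fun_prop)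
    have h2 : Differentiable ℂ fun z => theta τ (z - u) := hd.comp (by fun_prop)
    have h3 := differentiableAt_eisensteinTwo hτ hw
    exact (h3.sub_const _).add ((((h1 w).mul (h2 w)).const_mul k).div ((hd w).pow 2)
      (pow_ne_zero 2 this))
  · intro w _
    simp only [h]
    rw [eisensteinTwo_add_one hτ, theta_add_one hτ, show w + 1 + u = w + u + 1 by ring,
      show w + 1 - u = w - u + 1 by ring, theta_add_one hτ, theta_add_one hτ]
    ring
  · intro w hw
    simp only [h]
    have h1 := e_ne_zero (-τ / 2)
    have h2 := e_ne_zero (-w)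
    have h3 := theta_ne_zero hτ hw
    have h4 := e_ne_zero u
    rw [eisensteinTwo_add_tau hτ hw, theta_add_tau hτ, show w + τ + u = w + u + τ by ring,
      show w + τ - u = w - u + τ by ring, theta_add_tau hτ, theta_add_tau hτ,
      show -(w + u) = -w + -u by ring, show -(w - u) = -w + u by ring, e_add, e_add, e_neg u]
    generalize e (-τ / 2) = a at *
    field_simp
  · exact (hdF 0).div ((hdt 0).pow 2) (pow_ne_zero 2 (by
      rw [dslope_same]; exact deriv_theta_zero_ne_zero hτ))
  · filter_upwards [eventually_nhdsNE_zero_notMem_periodLattice hτ, self_mem_nhdsWithin]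
      with w hw hw0
    have hw0 : w ≠ 0 := hw0
    rw [hhF w hw, hFG, theta_eq_mul_dslope τ w]
    have h1 : dslope (theta τ) 0 w ≠ 0 := fun h1 => theta_ne_zero hτ hw (by
      rw [theta_eq_mul_dslope, h1, mul_zero])
    field_simp

/-! ### Product formula, quasi-periodicity and pole of the Kronecker function. -/

lemma kronecker_mul_kronecker_neg (hτ : 0 < τ.im) {u z : ℂ} (hu : u ∉ periodLattice τ)
    (hz : z ∉ periodLattice τ) :
    kronecker τ u z * kronecker τ (-u) z = eisensteinTwo τ z - eisensteinTwo τ u := by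
  have h1 := theta_ne_zero hτ hu
  have h2 := theta_ne_zero hτ hz
  rw [eisensteinTwo_sub_eisensteinTwo hτ hu hz, kronecker, kronecker, theta_neg hτ,
    show u + z = z + u by ring, show -u + z = z - u by ring]
  field_simp

lemma kronecker_sub_one (hτ : 0 < τ.im) (u z : ℂ) : kronecker τ u (z - 1) = kronecker τ u z := by
  have h : ∀ w, theta τ (w - 1) = - theta τ w := fun w => by
    have := theta_add_one hτ (w - 1)
    rw [sub_add_cancel] at this
    rw [this, neg_neg]
  rw [kronecker, kronecker, ← add_sub_assoc, h, h]
  simp only [neg_mul, mul_neg, neg_div_neg_eq]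

lemma kronecker_add_tau (hτ : 0 < τ.im) (u z : ℂ) :
    kronecker τ u (z + τ) = e (-u) * kronecker τ u z := by
  have h1 := e_ne_zero (-τ / 2)
  have h2 := e_ne_zero (-z)
  rw [kronecker, kronecker, ← add_assoc, theta_add_tau hτ, theta_add_tau hτ, neg_add, e_add]
  rw [show -(e (-τ / 2) * (e (-u) * e (-z))) * theta τ (u + z) * deriv (theta τ) 0 =
      (-(e (-τ / 2) * e (-z))) * (e (-u) * (theta τ (u + z) * deriv (theta τ) 0)) by ring,
    show theta τ u * (-(e (-τ / 2) * e (-z)) * theta τ z) =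
      (-(e (-τ / 2) * e (-z))) * (theta τ u * theta τ z) by ring,
    mul_div_mul_left _ _ (neg_ne_zero.2 (mul_ne_zero h1 h2)), mul_div_assoc]

lemma kronecker_sub_tau_left (hτ : 0 < τ.im) (u z : ℂ) :
    kronecker τ (u - τ) z = e z * kronecker τ u z := by
  have h1 := e_ne_zero (-τ / 2)
  have h2 := e_ne_zero u
  rw [kronecker, kronecker, show u - τ + z = u + z - τ by ring, theta_sub_tau hτ,
    theta_sub_tau hτ, e_add]
  rw [show -(e (-τ / 2) * (e u * e z)) * theta τ (u + z) * deriv (theta τ) 0 =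
      (-(e (-τ / 2) * e u)) * (e z * (theta τ (u + z) * deriv (theta τ) 0)) by ring,
    show -(e (-τ / 2) * e u) * theta τ u * theta τ z =
      (-(e (-τ / 2) * e u)) * (theta τ u * theta τ z) by ring,
    mul_div_mul_left _ _ (neg_ne_zero.2 (mul_ne_zero h1 h2)), mul_div_assoc]

lemma differentiableAt_kronecker (hτ : 0 < τ.im) {u z : ℂ} (hu : u ∉ periodLattice τ)
    (hz : z ∉ periodLattice τ) : DifferentiableAt ℂ (kronecker τ u) z := by
  have hd := differentiable_theta hτ
  have h1 : Differentiable ℂ fun z => theta τ (u + z) := hd.comp (by fun_prop)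
  exact ((h1 z).mul_const _).div ((hd z).const_mul _)
    (mul_ne_zero (theta_ne_zero hτ hu) (theta_ne_zero hτ hz))

lemma tendsto_mul_kronecker (hτ : 0 < τ.im) {u : ℂ} (hu : u ∉ periodLattice τ) :
    Tendsto (fun z => z * kronecker τ u z) (𝓝[≠] 0) (𝓝 1) := by
  have hd := differentiable_theta hτ
  have hu0 := theta_ne_zero hτ hu
  have h0 := deriv_theta_zero_ne_zero hτ
  have h1 : Differentiable ℂ fun z => theta τ (u + z) := hd.comp (by fun_prop)
  have hg : ContinuousAt (fun z => theta τ (u + z) * deriv (theta τ) 0 /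
      (theta τ u * dslope (theta τ) 0 z)) 0 := by
    refine ContinuousAt.div (h1.continuous.continuousAt.mul_const _)
      ((differentiable_dslope hd 0).continuous.continuousAt.const_mul _) ?_
    rw [dslope_same]
    exact mul_ne_zero hu0 h0
  have hlim := hg.tendsto.mono_left (nhdsWithin_le_nhds (s := {0}ᶜ))
  rw [dslope_same, add_zero, div_self (mul_ne_zero hu0 h0)] at hlim
  refine hlim.congr' ?_
  filter_upwards [self_mem_nhdsWithin] with w hw
  have hw : w ≠ 0 := hw
  rw [kronecker, theta_eq_mul_dslope τ w, mul_left_comm, ← mul_div_assoc,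
    mul_div_mul_left _ _ hw]

/-! ### The twisted Kronecker function -/

variable {r : ℕ}

lemma kroneckerTwist_sub_one (hτ : 0 < τ.im) (m : ℕ) (u z : ℂ) :
    kroneckerTwist τ r (-m) u (z - 1) = e (m / r) * kroneckerTwist τ r (-m) u z := by
  rw [kroneckerTwist, kroneckerTwist, kronecker_sub_one hτ, ← mul_assoc, ← e_add]
  push_cast
  ring_nf

/-- The prefactor contributes `e(mτ/r)`, which cancels the part of the Kronecker multiplier coming
from the shift of `u`. -/
lemma kroneckerTwist_add_tau (hτ : 0 < τ.im) (m : ℤ) (u z : ℂ) :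
    kroneckerTwist τ r m u (z + τ) = e (-u) * kroneckerTwist τ r m u z := by
  rw [kroneckerTwist, kroneckerTwist, kronecker_add_tau hτ, ← mul_assoc, ← mul_assoc, ← e_add,
    ← e_add]
  ring_nf

lemma differentiableAt_kroneckerTwist (hτ : 0 < τ.im) {m : ℤ} {u z : ℂ}
    (hu : u + m * τ / r ∉ periodLattice τ) (hz : z ∉ periodLattice τ) :
    DifferentiableAt ℂ (kroneckerTwist τ r m u) z := by
  have : DifferentiableAt ℂ (fun z => e (m * z / r)) z := by unfold e; fun_prop
  exact this.mul (differentiableAt_kronecker hτ hu hz)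

lemma tendsto_mul_kroneckerTwist (hτ : 0 < τ.im) {m : ℤ} {u : ℂ}
    (hu : u + m * τ / r ∉ periodLattice τ) :
    Tendsto (fun z => z * kroneckerTwist τ r m u z) (𝓝[≠] 0) (𝓝 1) := by
  have h1 : Continuous (fun z : ℂ => e (m * z / r)) := by unfold e; fun_prop
  have h2 := (h1.tendsto 0).mono_left (nhdsWithin_le_nhds (s := {0}ᶜ))
  have := h2.mul (tendsto_mul_kronecker hτ hu)
  simp only [mul_zero, zero_div, e_zero, mul_one] at this
  refine this.congr fun z => ?_
  rw [kroneckerTwist]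
  ring

/-- Degree `0` is paired with itself, not with `r`, so no shift by `τ` enters here. -/
lemma kroneckerTwist_zero_mul (hτ : 0 < τ.im) {u z : ℂ} (hu : u ∉ periodLattice τ)
    (hz : z ∉ periodLattice τ) :
    kroneckerTwist τ r (-(0 : ℕ)) (-u) z * kroneckerTwist τ r (-(0 : ℕ)) u z =
      eisensteinTwo τ z - eisensteinTwo τ u := by
  rw [← kronecker_mul_kronecker_neg hτ hu hz, kroneckerTwist, kroneckerTwist]
  simp [e_zero, mul_comm]

/-- With `w = u + mτ/r`, the first arguments are `-w` and `w - τ`. Undoing the shift costs `e(z)`,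
which the two prefactors, with product `e(-z)`, absorb. -/
lemma kroneckerTwist_mul (hτ : 0 < τ.im) {m : ℕ} (hmr : m < r) {u z : ℂ}
    (hu : u + m * τ / r ∉ periodLattice τ) (hz : z ∉ periodLattice τ) :
    kroneckerTwist τ r (-m) (-u) z * kroneckerTwist τ r (-(r - m : ℕ)) u z =
      eisensteinTwo τ z - eisensteinTwo τ (u + m * τ / r) := by
  have hr : (r : ℂ) ≠ 0 := by exact_mod_cast (by omega : r ≠ 0)
  rw [← kronecker_mul_kronecker_neg hτ hu hz, kroneckerTwist, kroneckerTwist]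
  push_cast [Nat.cast_sub hmr.le]
  rw [show -u + -(m : ℂ) * τ / r = -(u + m * τ / r) by ring,
    show u + -((r : ℂ) - m) * τ / r = u + m * τ / r - τ by field_simp; ring,
    kronecker_sub_tau_left hτ]
  have he : e (-m * z / r) * e (-(r - m) * z / r) * e z = 1 := by
    rw [← e_add, ← e_add, show -(m : ℂ) * z / r + -(r - m) * z / r + z = 0 by
      field_simp; ring, e_zero]
  linear_combination kronecker τ (-(u + m * τ / r)) z * kronecker τ (u + m * τ / r) z * he

lemma natCast_mul_div_notMem_periodLattice (hτ : 0 < τ.im) {m : ℕ} (h0 : m ≠ 0) (hmr : m < r) :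
    (m : ℂ) * τ / r ∉ periodLattice τ := by
  rintro ⟨a, b, h⟩
  have hr : (r : ℂ) ≠ 0 := by exact_mod_cast (by omega : r ≠ 0)
  have h1 : ((m : ℂ) - b * r) * τ = ((a * r : ℤ) : ℂ) := by
    field_simp at h
    push_cast
    linear_combination h
  have h2 := congrArg Complex.im h1
  rw [show ((m : ℂ) - b * r) = (((m : ℤ) - b * r : ℤ) : ℂ) by push_cast; ring] at h2
  simp only [Complex.mul_im, Complex.intCast_re, Complex.intCast_im, zero_mul, add_zero] at h2
  have h3 : (m : ℤ) - b * r = 0 := by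
    have := (mul_eq_zero.1 h2).resolve_right hτ.ne'
    exact_mod_cast this
  have h4 : (m : ℤ) = b * r := by omega
  have hdvd : r ∣ m := by
    exact Int.natCast_dvd_natCast.1 (Dvd.intro_left b h4.symm)
  exact absurd (Nat.le_of_dvd (Nat.pos_of_ne_zero h0) hdvd) (by omega)

end Kronecker

/-! ### The action of the automorphism on roots and the pairing of weight vectors -/

section Lie

open LieAlgebra LieAlgebra.IsKilling LieModule

variable {𝔤 : Type*} [LieRing 𝔤] [LieAlgebra ℂ 𝔤]

/-! ### Bilinearity of the invariant form and orthogonality of root spaces. -/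

section Form

variable {c : ℂ}

lemma form_comm (x y : 𝔤) : form c x y = form c y x := by
  rw [form, form, LieModule.traceForm_comm]

lemma form_add_left (x y z : 𝔤) : form c (x + y) z = form c x z + form c y z := by
  simp [form, mul_add]

lemma form_add_right (x y z : 𝔤) : form c x (y + z) = form c x y + form c x z := by
  simp [form, mul_add]

lemma form_smul_left (a : ℂ) (x y : 𝔤) : form c (a • x) y = a * form c x y := by
  simp [form, mul_left_comm]

lemma form_smul_right (a : ℂ) (x y : 𝔤) : form c x (a • y) = a * form c x y := by
  simp [form, mul_left_comm]

lemma form_sum_left {ι : Type*} (s : Finset ι) (f : ι → 𝔤) (y : 𝔤) :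
    form c (∑ i ∈ s, f i) y = ∑ i ∈ s, form c (f i) y := by
  simp [form, Finset.mul_sum, LinearMap.sum_apply]

lemma form_sum_right {ι : Type*} (s : Finset ι) (f : ι → 𝔤) (x : 𝔤) :
    form c x (∑ i ∈ s, f i) = ∑ i ∈ s, form c x (f i) := by
  simp [form, Finset.mul_sum]

end Form

/-- The condition says `r ∣ m + n`, and the bounds leave `m + n = 0` or `m + n = r`; reduction
modulo `r` sends `m = 0` to the partner `0`. -/
lemma e_natCast_div_mul_eq_one_iff {r m n : ℕ} (hm : m < r) (hn : n < r) :
    e (m / r) * e (n / r) = 1 ↔ n = (r - m) % r := by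
  have hr : (r : ℂ) ≠ 0 := by exact_mod_cast (by omega : r ≠ 0)
  rw [← e_add, e_eq_one_iff]
  have hmod : (r - m) % r = if m = 0 then 0 else r - m := by
    split_ifs with h
    · simp [h]
    · exact Nat.mod_eq_of_lt (by omega)
  rw [hmod]
  constructor
  · rintro ⟨k, hk⟩
    have h1 : ((m + n : ℕ) : ℤ) = r * k := by
      have : ((m : ℂ) + n) = r * k := by
        rw [← hk]; field_simp
      exact_mod_cast this
    have h2 : r ∣ m + n := Int.natCast_dvd_natCast.1 ⟨k, h1⟩
    obtain ⟨q, hq⟩ := h2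
    have hq2 : q < 2 := by
      by_contra h
      have : r * 2 ≤ r * q := Nat.mul_le_mul_left r (by omega)
      omega
    interval_cases q
    · split_ifs <;> omega
    · split_ifs <;> omega
  · intro h
    split_ifs at h with h0
    · exact ⟨0, by simp [h0, h]⟩
    · refine ⟨1, ?_⟩
      rw [h, Nat.cast_sub hm.le]
      field_simp
      simp

lemma sum_range_add_one_of_eq {M : Type*} [AddCommGroup M] (f : ℕ → M) {r : ℕ} (h : f r = f 0) :
    ∑ j ∈ Finset.range r, f (j + 1) = ∑ j ∈ Finset.range r, f j := by
  have h1 := Finset.sum_range_succ f r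
  rw [Finset.sum_range_succ', h] at h1
  exact add_right_cancel h1

lemma form_eq_zero_of_mem_of_mem_rootSpace [FiniteDimensional ℂ 𝔤]
    {H : LieSubalgebra ℂ 𝔤} [H.IsCartanSubalgebra] {c : ℂ} {α : Weight ℂ H 𝔤} (hα : α ∈ H.root) {x y : 𝔤}
    (hx : x ∈ H) (hy : y ∈ rootSpace H α) : form c x y = 0 := by
  have hx0 : x ∈ rootSpace H (0 : H → ℂ) := toLieSubmodule_le_rootSpace_zero ℂ 𝔤 H hx
  rw [form, killingForm_apply_eq_zero_of_mem_rootSpace_of_add_ne_zero ℂ 𝔤 H hx0 hy, mul_zero]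
  rw [zero_add]
  exact (Finset.mem_filter.1 hα).2

variable [FiniteDimensional ℂ 𝔤] [LieAlgebra.IsSimple ℂ 𝔤]
  {H : LieSubalgebra ℂ 𝔤} [H.IsCartanSubalgebra]
  {b : (LieAlgebra.IsKilling.rootSystem H).Base}

lemma form_eq_zero_of_ne_neg {c : ℂ} {α β : Weight ℂ H 𝔤} {x y : 𝔤} (hx : x ∈ rootSpace H α)
    (hy : y ∈ rootSpace H β) (h : β ≠ -α) : form c x y = 0 := by
  rw [form, killingForm_apply_eq_zero_of_mem_rootSpace_of_add_ne_zero ℂ 𝔤 H hx hy, mul_zero]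
  intro h'
  apply h
  ext z
  have := congrFun h' z
  simp only [Pi.add_apply, Pi.zero_apply] at this
  rw [Weight.coe_neg, Pi.neg_apply]
  linear_combination this

/-! ### The automorphism on root spaces, roots and invariant elements. -/

namespace DiagramAutomorphism

variable (ν : DiagramAutomorphism H b)

lemma form_lin_lin {c : ℂ} (x y : 𝔤) : form c (ν.lin x) (ν.lin y) = form c x y := by
  rw [form, form]
  congr 1
  exact killingForm_of_equiv_apply ν.toEquiv x y

lemma form_lin_pow {c : ℂ} (x y : 𝔤) (j : ℕ) :
    form c ((ν.lin ^ j) x) ((ν.lin ^ j) y) = form c x y := by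
  induction j with
  | zero => simp
  | succ n ih => rw [pow_succ', Module.End.mul_apply, Module.End.mul_apply, form_lin_lin, ih]

lemma lin_lie (x y : 𝔤) : ν.lin ⁅x, y⁆ = ⁅ν.lin x, ν.lin y⁆ := LieEquiv.map_lie ν.toEquiv x y

lemma lin_mem {x : 𝔤} (hx : x ∈ H) : ν.lin x ∈ H := ν.map_mem x hx

lemma lin_pow_mem {x : 𝔤} (hx : x ∈ H) (j : ℕ) : (ν.lin ^ j) x ∈ H := by
  induction j with
  | zero => simpa
  | succ n ih => rw [pow_succ', Module.End.mul_apply]; exact ν.lin_mem ih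

lemma perm_apply_lin (α : Weight ℂ H 𝔤) (h : H) :
    (ν.perm α) ⟨ν.lin h, ν.lin_mem h.2⟩ = α h := ν.perm_apply α h

lemma perm_pow_apply_lin_pow (α : Weight ℂ H 𝔤) (h : H) (j : ℕ) :
    ((ν.perm ^ j) α) ⟨(ν.lin ^ j) h, ν.lin_pow_mem h.2 j⟩ = α h := by
  induction j with
  | zero => simp
  | succ n ih =>
    rw [← ih]
    have := ν.perm_apply_lin ((ν.perm ^ n) α) ⟨(ν.lin ^ n) h, ν.lin_pow_mem h.2 n⟩
    simpa only [pow_succ', Module.End.mul_apply, Equiv.Perm.mul_apply] using this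

lemma exists_lin_eq (h : H) : ∃ h' : H, ν.lin h' = h := by
  have hinj : Function.Injective (ν.lin.restrict fun x (hx : x ∈ H.toSubmodule) => ν.lin_mem hx) := by
    intro x y hxy
    have := congrArg Subtype.val hxy
    exact Subtype.ext (ν.toEquiv.injective this)
  obtain ⟨h', hh'⟩ := LinearMap.surjective_of_injective hinj h
  exact ⟨h', congrArg Subtype.val hh'⟩

lemma lin_mem_rootSpace {α : Weight ℂ H 𝔤} {x : 𝔤} (hx : x ∈ rootSpace H α) :
    ν.lin x ∈ rootSpace H (ν.perm α) := by
  refine weightSpace_le_genWeightSpace 𝔤 _ ((mem_weightSpace _ _).2 fun h => ?_)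
  obtain ⟨h', hh'⟩ := ν.exists_lin_eq h
  have h1 : h = ⟨ν.lin h', ν.lin_mem h'.2⟩ := Subtype.ext hh'.symm
  have h2 : ⁅(h' : 𝔤), x⁆ = α h' • x := lie_eq_smul_of_mem_rootSpace hx h'
  rw [h1, ν.perm_apply_lin, ← map_smul, ← h2, ν.lin_lie]
  rfl

lemma lin_pow_mem_rootSpace {α : Weight ℂ H 𝔤} {x : 𝔤} (hx : x ∈ rootSpace H α) (j : ℕ) :
    (ν.lin ^ j) x ∈ rootSpace H ((ν.perm ^ j) α) := by
  induction j with
  | zero => simpa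
  | succ n ih =>
    rw [pow_succ', pow_succ', Module.End.mul_apply, Equiv.Perm.mul_apply]
    exact ν.lin_mem_rootSpace ih

lemma perm_neg (α : Weight ℂ H 𝔤) : ν.perm (-α) = -ν.perm α := by
  ext h
  obtain ⟨h', hh'⟩ := ν.exists_lin_eq h
  have h1 : h = ⟨ν.lin h', ν.lin_mem h'.2⟩ := Subtype.ext hh'.symm
  rw [h1, ν.perm_apply_lin, Weight.coe_neg, Weight.coe_neg, Pi.neg_apply, Pi.neg_apply, ν.perm_apply_lin]

lemma perm_pow_neg (α : Weight ℂ H 𝔤) (j : ℕ) : (ν.perm ^ j) (-α) = -(ν.perm ^ j) α := by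
  induction j with
  | zero => simp
  | succ n ih =>
    rw [pow_succ', Equiv.Perm.mul_apply, Equiv.Perm.mul_apply, ih, perm_neg]

lemma perm_mem_root {α : Weight ℂ H 𝔤} (hα : α ∈ H.root) : ν.perm α ∈ H.root := by
  simp only [LieSubalgebra.root, Finset.mem_filter, Finset.mem_univ, true_and] at hα ⊢
  intro h0
  apply hα
  funext h
  rw [← ν.perm_apply_lin, h0]
  rfl

lemma perm_pow_mem_root {α : Weight ℂ H 𝔤} (hα : α ∈ H.root) (j : ℕ) :
    (ν.perm ^ j) α ∈ H.root := by
  induction j with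
  | zero => exact hα
  | succ n ih => rw [pow_succ', Equiv.Perm.mul_apply]; exact ν.perm_mem_root ih

variable {ν} {r : ℕ}

lemma perm_pow_eq (hν : ν.lin ^ r = 1) (α : Weight ℂ H 𝔤) : (ν.perm ^ r) α = α := by
  ext h
  conv_rhs => rw [← ν.perm_pow_apply_lin_pow α h r]
  congr 1
  simp [hν]

/-- For prime `r` the orbits have length `1` or `r`: periods `k` and `r` would give the period
`gcd(r, k) = 1`. -/
lemma perm_pow_ne (hr : r.Prime) (hν : ν.lin ^ r = 1) {α : Weight ℂ H 𝔤} (hα : ν.perm α ≠ α)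
    {k : ℕ} (hk : k < r) (hk0 : k ≠ 0) : (ν.perm ^ k) α ≠ α := by
  intro h
  have h1 : Function.IsPeriodicPt ν.perm r α := by
    rw [Function.IsPeriodicPt, Equiv.Perm.iterate_eq_pow]; exact perm_pow_eq hν α
  have h2 : Function.IsPeriodicPt ν.perm k α := by
    rw [Function.IsPeriodicPt, Equiv.Perm.iterate_eq_pow]; exact h
  have h3 := h1.gcd h2
  rw [((Nat.Prime.coprime_iff_not_dvd hr).2 fun h => absurd
    (Nat.le_of_dvd (Nat.pos_of_ne_zero hk0) h) (by omega) : Nat.gcd r k = 1)] at h3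
  exact hα h3

variable (r) in
lemma avgRoot_neg (α : Weight ℂ H 𝔤) (x : H) : avgRoot ν r (-α) x = - avgRoot ν r α x := by
  simp only [avgRoot, perm_pow_neg, Weight.coe_neg, Pi.neg_apply, Finset.sum_neg_distrib, mul_neg]

lemma invariantPart_mem {x : 𝔤} (hx : x ∈ H) : invariantPart ν r x ∈ H :=
  H.smul_mem _ (sum_mem fun j _ => ν.lin_pow_mem hx j)

lemma lin_invariantPart (hν : ν.lin ^ r = 1) (x : 𝔤) :
    ν.lin (invariantPart ν r x) = invariantPart ν r x := by
  rw [invariantPart, map_smul, map_sum]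
  congr 1
  rw [← sum_range_add_one_of_eq (fun j => (ν.lin ^ j) x) (by simp [hν])]
  exact Finset.sum_congr rfl fun j _ => by rw [pow_succ', Module.End.mul_apply]

lemma perm_pow_apply_of_lin_eq {y : H} (hy : ν.lin y = y) (α : Weight ℂ H 𝔤) (j : ℕ) :
    ((ν.perm ^ j) α) y = α y := by
  have hp : (ν.lin ^ j) (y : 𝔤) = y := by
    induction j with
    | zero => simp
    | succ n ih => rw [pow_succ, Module.End.mul_apply, hy, ih]
  rw [← ν.perm_pow_apply_lin_pow α y j]
  congr 1
  exact Subtype.ext hp.symm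

/-- Averaging the argument is the same as averaging the root, because `α(ν^j x) = (ν̄^{r-j} α)(x)`.
-/
lemma apply_invariantPart (hν : ν.lin ^ r = 1) (α : Weight ℂ H 𝔤) (x : H) :
    α ⟨invariantPart ν r x, invariantPart_mem x.2⟩ = avgRoot ν r α x := by
  have h1 : (⟨invariantPart ν r x, invariantPart_mem x.2⟩ : H) =
      (r : ℂ)⁻¹ • ∑ j ∈ Finset.range r, (⟨(ν.lin ^ j) x, ν.lin_pow_mem x.2 j⟩ : H) := by
    apply Subtype.ext
    simp [invariantPart]
  have h2 : ∀ y : H, α y = α.toLinear ℂ H 𝔤 y := fun y => rfl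
  rw [h1, h2, map_smul, map_sum, smul_eq_mul, avgRoot]
  congr 1
  -- The exponent `r - j` is written `r - 1 - j + 1` to fit the reflection `j ↦ r - 1 - j`, followed
  -- by a cyclic shift by one.
  have h3 : ∀ j ∈ Finset.range r, α.toLinear ℂ H 𝔤 ⟨(ν.lin ^ j) x, ν.lin_pow_mem x.2 j⟩ =
      ((ν.perm ^ (r - 1 - j + 1)) α) x := by
    intro j hj
    have hj : j < r := Finset.mem_range.1 hj
    rw [← h2, ← ν.perm_pow_apply_lin_pow α _ (r - 1 - j + 1)]
    congr 1
    apply Subtype.ext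
    simp only
    rw [← Module.End.mul_apply, ← pow_add, show r - 1 - j + 1 + j = r by omega, hν,
      Module.End.one_apply]
  rw [Finset.sum_congr rfl h3,
    Finset.sum_range_reflect (fun j => ((ν.perm ^ (j + 1)) α) x) r]
  exact sum_range_add_one_of_eq (fun j => ((ν.perm ^ j) α) x) (by rw [perm_pow_eq hν]; simp)

lemma avgRoot_add (α : Weight ℂ H 𝔤) (x y : H) :
    avgRoot ν r α (x + y) = avgRoot ν r α x + avgRoot ν r α y := by
  have h2 : ∀ (β : Weight ℂ H 𝔤) (y : H), β y = β.toLinear ℂ H 𝔤 y := fun _ _ => rfl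
  simp only [avgRoot, h2, map_add, Finset.sum_add_distrib, mul_add]

lemma avgRoot_of_lin_eq (hr : r ≠ 0) {y : H} (hy : ν.lin y = y) (α : Weight ℂ H 𝔤) :
    avgRoot ν r α y = α y := by
  have : (r : ℂ) ≠ 0 := by exact_mod_cast hr
  simp only [avgRoot, perm_pow_apply_of_lin_eq hy, Finset.sum_const, Finset.card_range,
    nsmul_eq_mul]
  field_simp

end DiagramAutomorphism

open DiagramAutomorphism

/-! ### Duality of the adapted bases. -/

namespace AdaptedBasis

variable {ν : DiagramAutomorphism H b} {r : ℕ} {c : ℂ} (B : AdaptedBasis ν r c)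

lemma mem_weights {m : ℕ} {α : Weight ℂ H 𝔤} :
    α ∈ B.weights m ↔ α ∈ B.reps ∧ (ν.perm α ≠ α ∨ ν.lin (B.E α) = e (m / r) • B.E α) := by
  simp [weights]

lemma mem_root_of_mem_weights {m : ℕ} {α : Weight ℂ H 𝔤} (hα : α ∈ B.weights m) : α ∈ H.root :=
  B.reps_subset (B.mem_weights.1 hα).1

lemma vec_of_perm_eq {α : Weight ℂ H 𝔤} (hα : ν.perm α = α) (m : ℕ) : B.vec m α = B.E α :=
  if_pos hα

lemma vec_of_perm_ne {α : Weight ℂ H 𝔤} (hα : ν.perm α ≠ α) (m : ℕ) :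
    B.vec m α = ∑ j ∈ Finset.range r, e (-((j : ℂ) * m / r)) • (ν.lin ^ j) (B.E α) :=
  if_neg hα

variable {B}

/-- On a free orbit the vector is a discrete Fourier sum, and `ν` shifts it cyclically; for a fixed
root the eigenvalue is built into the weight set. -/
lemma lin_vec (hν : ν.lin ^ r = 1) (hr : r ≠ 0) {m : ℕ} {α : Weight ℂ H 𝔤}
    (hα : α ∈ B.weights m) : ν.lin (B.vec m α) = e (m / r) • B.vec m α := by
  have hr' : (r : ℂ) ≠ 0 := by exact_mod_cast hr
  by_cases hp : ν.perm α = α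
  · rw [vec_of_perm_eq B hp]
    exact (B.mem_weights.1 hα).2.resolve_left (not_not.2 hp)
  · rw [vec_of_perm_ne B hp, map_sum, Finset.smul_sum,
      ← sum_range_add_one_of_eq
        (fun j : ℕ => e (m / r) • e (-((j : ℂ) * m / r)) • (ν.lin ^ j) (B.E α)) ?_]
    · refine Finset.sum_congr rfl fun j _ => ?_
      rw [map_smul, smul_smul, ← e_add, pow_succ', Module.End.mul_apply]
      congr 2
      push_cast
      ring
    · have : e (-((r : ℂ) * m / r)) = 1 := by
        rw [mul_div_cancel_left₀ _ hr', e_neg, ← Int.cast_natCast, e_intCast, inv_one]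
      rw [this, hν]
      simp [e_zero]

lemma lin_pow_vec (hν : ν.lin ^ r = 1) (hr : r ≠ 0) {m : ℕ} {α : Weight ℂ H 𝔤}
    (hα : α ∈ B.weights m) (j : ℕ) :
    (ν.lin ^ j) (B.vec m α) = e ((j : ℂ) * m / r) • B.vec m α := by
  induction j with
  | zero => simp [e_zero]
  | succ n ih =>
    rw [pow_succ', Module.End.mul_apply, ih, map_smul, lin_vec hν hr hα, smul_smul, ← e_add]
    congr 2
    push_cast
    ring

/-- By invariance of the form, and because the right-hand vector has the inverse eigenvalue, every
term of the orbit sum contributes the same amount. -/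
lemma form_vec_left (hν : ν.lin ^ r = 1) (hr : r ≠ 0) {m n : ℕ}
    (hmn : e (m / r) * e (n / r) = 1) {α β : Weight ℂ H 𝔤} (hβ : β ∈ B.weights n) :
    form c (B.vec m α) (B.vec n β) = B.len α * form c (B.E α) (B.vec n β) := by
  by_cases hp : ν.perm α = α
  · rw [vec_of_perm_eq B hp, len, if_pos hp, one_mul]
  · rw [vec_of_perm_ne B hp, form_sum_left, len, if_neg hp]
    have : ∀ j ∈ Finset.range r, form c (e (-((j : ℂ) * m / r)) • (ν.lin ^ j) (B.E α))
        (B.vec n β) = form c (B.E α) (B.vec n β) := by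
      intro j _
      have h1 : B.vec n β = e (-((j : ℂ) * n / r)) • (ν.lin ^ j) (B.vec n β) := by
        rw [lin_pow_vec hν hr hβ, smul_smul, ← e_add, neg_add_cancel, e_zero, one_smul]
      conv_lhs => rw [h1]
      rw [form_smul_left, form_smul_right, form_lin_pow, ← mul_assoc, ← e_add]
      have h2 : e (-((j : ℂ) * m / r) + -((j : ℂ) * n / r)) = 1 := by
        rw [← e_add] at hmn
        rw [show -((j : ℂ) * m / r) + -((j : ℂ) * n / r) = -(j * (m / r + n / r)) by ring,
          e_neg, e_natMul, hmn, one_pow, inv_one]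
      rw [h2, one_mul]
    rw [Finset.sum_congr rfl this, Finset.sum_const, Finset.card_range, nsmul_eq_mul]

lemma eq_of_perm_pow_eq {α β : Weight ℂ H 𝔤} (hα : α ∈ B.reps) (hβ : β ∈ B.reps) {k : ℕ}
    (h : (ν.perm ^ k) β = α) : α = β :=
  (B.reps_unique β (B.reps_subset hβ)).unique ⟨hα, k, h.symm⟩ ⟨hβ, 0, by simp⟩

lemma form_E_vec (hrp : r.Prime) (hν : ν.lin ^ r = 1) {m n : ℕ} {α β : Weight ℂ H 𝔤}
    (hα : α ∈ B.weights m) (hβ : β ∈ B.weights n) [Decidable (β = -α)] :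
    form c (B.E α) (B.vec n β) = if β = -α then 1 else 0 := by
  have hα' := (B.mem_weights.1 hα).1
  have hβ' := (B.mem_weights.1 hβ).1
  have hαE := B.E_mem α (B.reps_subset hα')
  have hβE := B.E_mem β (B.reps_subset hβ')
  have hne : ∀ k, β ≠ -α → form c (B.E α) ((ν.lin ^ k) (B.E β)) = 0 := fun k h =>
    form_eq_zero_of_ne_neg hαE (ν.lin_pow_mem_rootSpace hβE k) fun h' =>
      h (eq_of_perm_pow_eq (B.reps_neg α hα') hβ' h').symm
  split_ifs with h
  · by_cases hp : ν.perm β = β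
    · rw [vec_of_perm_eq B hp, h]
      exact B.E_pair α (B.reps_subset hα')
    -- On a free orbit only the term `j = 0` has weight `-α`.
    · rw [vec_of_perm_ne B hp, form_sum_right, Finset.sum_eq_single 0]
      · rw [h]
        simpa [e_zero] using B.E_pair α (B.reps_subset hα')
      · intro k hk hk0
        rw [form_smul_right, form_eq_zero_of_ne_neg hαE (ν.lin_pow_mem_rootSpace hβE k),
          mul_zero]
        rw [← h]
        exact perm_pow_ne hrp hν hp (Finset.mem_range.1 hk) hk0
      · intro h0
        exact absurd (Finset.mem_range.2 hrp.pos) h0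
  · by_cases hp : ν.perm β = β
    · rw [vec_of_perm_eq B hp]
      simpa using hne 0 h
    · rw [vec_of_perm_ne B hp, form_sum_right]
      exact Finset.sum_eq_zero fun k _ => by rw [form_smul_right, hne k h, mul_zero]

/-- For a fixed root, `ν` acts on the line spanned by `E_{-α}` by a scalar; since it preserves
`(E_α, E_{-α}) = 1`, that scalar is inverse to the one on `E_α`. -/
lemma neg_mem_weights {m n : ℕ} (hmn : e (m / r) * e (n / r) = 1) {α : Weight ℂ H 𝔤}
    (hα : α ∈ B.weights m) : -α ∈ B.weights n := by
  obtain ⟨hα1, hα2⟩ := B.mem_weights.1 hα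
  have hr1 := B.reps_subset hα1
  have hn1 := B.reps_neg α hα1
  have hr2 := B.reps_subset hn1
  refine B.mem_weights.2 ⟨hn1, ?_⟩
  by_cases hp : ν.perm α = α
  · right
    have hα3 := hα2.resolve_left (not_not.2 hp)
    have hfin := finrank_rootSpace_eq_one (-α) (by simpa [LieSubalgebra.root] using hr2)
    have hE := B.E_mem _ hr2
    have hpair := B.E_pair α hr1
    have hE0 : (⟨B.E (-α), hE⟩ : rootSpace H (-α : Weight ℂ H 𝔤)) ≠ 0 := by
      intro h0
      have h0' : B.E (-α) = 0 := congrArg Subtype.val h0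
      rw [h0'] at hpair
      simp [form] at hpair
    have hνE : ν.lin (B.E (-α)) ∈ rootSpace H (-α : Weight ℂ H 𝔤) := by
      have := ν.lin_mem_rootSpace hE
      rwa [perm_neg, hp] at this
    obtain ⟨k, hk⟩ := (finrank_eq_one_iff_of_nonzero' _ hE0).1 hfin ⟨_, hνE⟩
    have hk : k • B.E (-α) = ν.lin (B.E (-α)) := congrArg Subtype.val hk
    have h1 := ν.form_lin_lin (c := c) (B.E α) (B.E (-α))
    rw [hα3, ← hk, form_smul_left, form_smul_right, hpair, mul_one] at h1
    rw [← hk]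
    congr 1
    exact mul_left_cancel₀ (e_ne_zero _) (h1.trans hmn.symm)
  · left
    rw [perm_neg]
    exact fun h => hp (neg_injective h)

lemma form_h_vec {m : ℕ} {x : 𝔤} (hx : x ∈ H) {α : Weight ℂ H 𝔤}
    (hα : α ∈ B.weights m) : form c x (B.vec m α) = 0 := by
  have hα' := B.mem_root_of_mem_weights hα
  have h : ∀ j, form c x ((ν.lin ^ j) (B.E α)) = 0 := fun j =>
    form_eq_zero_of_mem_of_mem_rootSpace (ν.perm_pow_mem_root hα' j) hx
      (ν.lin_pow_mem_rootSpace (B.E_mem α hα') j)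
  by_cases hp : ν.perm α = α
  · rw [vec_of_perm_eq B hp]; simpa using h 0
  · rw [vec_of_perm_ne B hp, form_sum_right]
    exact Finset.sum_eq_zero fun k _ => by rw [form_smul_right, h k, mul_zero]

variable (B) in
/-- The element of `𝔤_m` with given coordinates in the basis `e^m_k`, `t^m_α`. -/
noncomputable def combination (m : ℕ) (a : ℕ → ℂ) (s : Weight ℂ H 𝔤 → ℂ) : 𝔤 :=
  ∑ k ∈ Finset.range (B.n m), a k • B.h m k + ∑ α ∈ B.weights m, s α • B.vec m α

lemma lin_combination (hν : ν.lin ^ r = 1) {m : ℕ} (hm : m < r) (a : ℕ → ℂ)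
    (s : Weight ℂ H 𝔤 → ℂ) :
    ν.lin (B.combination m a s) = e (m / r) • B.combination m a s := by
  rw [combination, map_add, map_sum, map_sum, smul_add, Finset.smul_sum, Finset.smul_sum]
  congr 1
  · refine Finset.sum_congr rfl fun k hk => ?_
    rw [map_smul, (B.h_mem m hm k (Finset.mem_range.1 hk)).2, smul_comm]
  · refine Finset.sum_congr rfl fun α hα => ?_
    rw [map_smul, lin_vec hν (by omega) hα, smul_comm]

lemma form_combination (hrp : r.Prime) (hν : ν.lin ^ r = 1) {m n : ℕ} (hm : m < r)
    (hn : n = (r - m) % r) (a a' : ℕ → ℂ) (s s' : Weight ℂ H 𝔤 → ℂ) :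
    form c (B.combination m a s) (B.combination n a' s') =
      ∑ k ∈ Finset.range (B.n m), a k * a' k +
        ∑ α ∈ B.weights m, B.len α * s α * s' (-α) := by
  classical
  have hnr : n < r := hn ▸ Nat.mod_lt _ hrp.pos
  have hmn : e (m / r) * e (n / r) = 1 := (e_natCast_div_mul_eq_one_iff hm hnr).2 hn
  have hBn : B.n n = B.n m := hn ▸ B.n_symm m hm
  have hh : ∀ i < r, ∀ k ∈ Finset.range (B.n i), B.h i k ∈ H := fun i hi k hk =>
    (B.h_mem i hi k (Finset.mem_range.1 hk)).1
  have h1 : form c (∑ k ∈ Finset.range (B.n m), a k • B.h m k)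
      (∑ α ∈ B.weights n, s' α • B.vec n α) = 0 := by
    rw [form_sum_left]
    refine Finset.sum_eq_zero fun k hk => ?_
    rw [form_sum_right]
    refine Finset.sum_eq_zero fun α hα => ?_
    rw [form_smul_left, form_smul_right, form_h_vec (hh m hm k hk) hα, mul_zero, mul_zero]
  have h2 : form c (∑ α ∈ B.weights m, s α • B.vec m α)
      (∑ k ∈ Finset.range (B.n n), a' k • B.h n k) = 0 := by
    rw [form_sum_left]
    refine Finset.sum_eq_zero fun α hα => ?_
    rw [form_sum_right]
    refine Finset.sum_eq_zero fun k hk => ?_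
    rw [form_smul_left, form_smul_right, form_comm, form_h_vec (hh n hnr k hk) hα, mul_zero,
      mul_zero]
  rw [combination, combination, form_add_left, form_add_right, form_add_right, h1, h2, add_zero,
    zero_add]
  congr 1
  · rw [form_sum_left]
    refine Finset.sum_congr rfl fun j hj => ?_
    rw [form_sum_right, hBn, Finset.sum_eq_single_of_mem j hj]
    · rw [form_smul_left, form_smul_right, hn, B.h_pair m hm j (Finset.mem_range.1 hj) j
        (Finset.mem_range.1 hj), if_pos rfl, mul_one]
    · intro k hk hkj
      rw [form_smul_left, form_smul_right, hn, B.h_pair m hm j (Finset.mem_range.1 hj) k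
        (Finset.mem_range.1 hk), if_neg hkj.symm, mul_zero, mul_zero]
  · rw [form_sum_left]
    refine Finset.sum_congr rfl fun α hα => ?_
    rw [form_sum_right, Finset.sum_eq_single_of_mem (-α) (neg_mem_weights hmn hα)]
    · rw [form_smul_left, form_smul_right, form_vec_left hν hrp.ne_zero hmn
        (neg_mem_weights hmn hα), form_E_vec hrp hν hα (neg_mem_weights hmn hα), if_pos rfl]
      ring
    · intro β hβ hne
      rw [form_smul_left, form_smul_right, form_vec_left hν hrp.ne_zero hmn hβ,
        form_E_vec hrp hν hα hβ, if_neg hne]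
      simp

end AdaptedBasis

/-- The invariant form of a sum of eigenvectors only pairs the degrees `m` and `-m`. -/
lemma form_sum_sum_of_lin_eq {ν : DiagramAutomorphism H b} {r : ℕ} {c : ℂ} (hr : 0 < r)
    {x : ℕ → 𝔤} (hx : ∀ m < r, ν.lin (x m) = e (m / r) • x m) :
    form c (∑ m ∈ Finset.range r, x m) (∑ m ∈ Finset.range r, x m) =
      form c (x 0) (x 0) + ∑ m ∈ Finset.Ico 1 r, form c (x m) (x (r - m)) := by
  have h1 : ∀ m ∈ Finset.range r, form c (x m) (∑ n ∈ Finset.range r, x n) =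
      form c (x m) (x ((r - m) % r)) := by
    intro m hm
    have hm := Finset.mem_range.1 hm
    rw [form_sum_right, Finset.sum_eq_single_of_mem _ (Finset.mem_range.2 (Nat.mod_lt _ hr))]
    intro n hn hne
    have hn := Finset.mem_range.1 hn
    have h2 := ν.form_lin_lin (c := c) (x m) (x n)
    rw [hx m hm, hx n hn, form_smul_left, form_smul_right, ← mul_assoc] at h2
    have h3 : e (m / r) * e (n / r) ≠ 1 := fun h =>
      hne ((e_natCast_div_mul_eq_one_iff hm hn).1 h)
    -- Applying `ν` to both arguments multiplies the pairing by `ω^{m+n}` without changing it.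
    have h4 : (e (m / r) * e (n / r) - 1) * form c (x m) (x n) = 0 := by
      linear_combination h2
    exact (mul_eq_zero.1 h4).resolve_left (sub_ne_zero.2 h3)
  rw [form_sum_left, Finset.sum_congr rfl h1, Finset.range_eq_Ico,
    Finset.sum_eq_sum_Ico_succ_bot hr]
  congr 1
  · simp
  · refine Finset.sum_congr rfl fun m hm => ?_
    have := Finset.mem_Ico.1 hm
    rw [Nat.mod_eq_of_lt (by omega)]

end Lie

/-! ### The exponential of the adjoint operator -/

section AdExp

open NormedSpace

attribute [local instance] Matrix.linftyOpNormedRing Matrix.linftyOpNormedAlgebra in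
-- Powers of `A` act on the eigenvector by powers of `a`, so the exponential series can be compared
-- term by term.
lemma exp_mulVec_of_mulVec_eq_smul {ι : Type*} [Fintype ι] [DecidableEq ι] {A : Matrix ι ι ℂ}
    {v : ι → ℂ} {a : ℂ} (h : A.mulVec v = a • v) : (exp A).mulVec v = Complex.exp a • v := by
  have h1 := exp_series_hasSum_exp' (𝕂 := ℂ) A
  have hn : ∀ n : ℕ, (A ^ n).mulVec v = a ^ n • v := by
    intro n
    induction n with
    | zero => simp
    | succ n ih =>
      rw [pow_succ', ← Matrix.mulVec_mulVec, ih, Matrix.mulVec_smul, h, smul_smul, pow_succ]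
  have hc : Continuous fun M : Matrix ι ι ℂ => M.mulVec v :=
    Continuous.matrix_mulVec continuous_id continuous_const
  have h2 := h1.map (⟨⟨fun M : Matrix ι ι ℂ => M.mulVec v, Matrix.zero_mulVec v⟩,
    fun M N => Matrix.add_mulVec M N v⟩ : Matrix ι ι ℂ →+ (ι → ℂ)) hc
  have h3 := (exp_series_hasSum_exp' (𝕂 := ℂ) a).smul_const v
  refine h2.unique ?_
  rw [Complex.exp_eq_exp_ℂ]
  refine h3.congr_fun ?_
  intro n
  simp [Matrix.smul_mulVec, hn, smul_smul]

variable {𝔤 : Type*} [LieRing 𝔤] [LieAlgebra ℂ 𝔤] [FiniteDimensional ℂ 𝔤]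

lemma AdExp_of_lie_eq_smul {x v : 𝔤} {a : ℂ} (h : ⁅x, v⁆ = a • v) : AdExp x v = e a • v := by
  apply (Module.finBasis ℂ 𝔤).repr.injective
  ext1 i
  have h1 := LinearMap.toMatrix_mulVec_repr (Module.finBasis ℂ 𝔤) (Module.finBasis ℂ 𝔤)
    (LieAlgebra.ad ℂ 𝔤 x : Module.End ℂ 𝔤) v
  have h2 := LinearMap.toMatrix_mulVec_repr (Module.finBasis ℂ 𝔤) (Module.finBasis ℂ 𝔤)
    (AdExp x) v
  rw [LieAlgebra.ad_apply, h, map_smul, Finsupp.coe_smul] at h1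
  rw [AdExp, LinearMap.toMatrix_toLin, exp_mulVec_of_mulVec_eq_smul
    (a := 2 * Real.pi * Complex.I * a) (by rw [Matrix.smul_mulVec, h1, smul_smul])] at h2
  rw [map_smul, Finsupp.smul_apply]
  exact (congrFun h2 i).symm

end AdExp

/-! ### The Lax operator -/

section Lax

open LieAlgebra LieAlgebra.IsKilling LieModule Filter

variable {𝔤 : Type*} [LieRing 𝔤] [LieAlgebra ℂ 𝔤] [FiniteDimensional ℂ 𝔤]
  [LieAlgebra.IsSimple ℂ 𝔤] {H : LieSubalgebra ℂ 𝔤} [H.IsCartanSubalgebra]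
  {b : (LieAlgebra.IsKilling.rootSystem H).Base}
  {ν : DiagramAutomorphism H b} {r : ℕ} {c : ℂ} {B : AdaptedBasis ν r c}
  {τ : ℂ} {x : H} {p : PhasePoint H}

/-- The coordinates of the Lax operator along the Cartan subalgebra. -/
noncomputable def cartanCoeff (τ : ℂ) (r : ℕ) (p : PhasePoint H) (m : ℕ) (z : ℂ) (k : ℕ) : ℂ :=
  if m = 0 then p.v k else p.spinH m k * kroneckerTwist τ r (-m) 0 z

/-- The coordinates of the Lax operator along the weight vectors. -/
noncomputable def weightCoeff (ν : DiagramAutomorphism H b) (τ : ℂ) (r : ℕ) (x : H)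
    (p : PhasePoint H) (m : ℕ) (z : ℂ) (α : Weight ℂ H 𝔤) : ℂ :=
  p.spinR m α * kroneckerTwist τ r (-m) (-avgRoot ν r α x) z

lemma laxComponent_eq (m : ℕ) (z : ℂ) :
    laxComponent B τ x p m z =
      B.combination m (cartanCoeff τ r p m z) (weightCoeff ν τ r x p m z) := by
  rw [laxComponent, AdaptedBasis.combination]
  by_cases h : m = 0
  · simp [cartanCoeff, weightCoeff, h]
  · simp [cartanCoeff, weightCoeff, h]

lemma residueComponent_eq (m : ℕ) :
    residueComponent B p m =
      B.combination m (fun k => if m = 0 then 0 else p.spinH m k) (p.spinR m) := by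
  rw [residueComponent, AdaptedBasis.combination]
  by_cases h : m = 0
  · simp [h]
  · simp [h]

lemma laxComponent_sub_one (hτ : 0 < τ.im) (m : ℕ) (z : ℂ) :
    laxComponent B τ x p m (z - 1) = e (m / r) • laxComponent B τ x p m z := by
  have h1 : cartanCoeff τ r p m (z - 1) = fun k => e (m / r) * cartanCoeff τ r p m z k := by
    funext k
    by_cases h : m = 0
    · simp [cartanCoeff, h, e_zero]
    · simp [cartanCoeff, h, kroneckerTwist_sub_one hτ, mul_left_comm]
  have h2 : weightCoeff ν τ r x p m (z - 1) =
      fun α => e (m / r) * weightCoeff ν τ r x p m z α := by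
    funext α
    simp [weightCoeff, kroneckerTwist_sub_one hτ, mul_left_comm]
  simp only [laxComponent_eq, h1, h2, AdaptedBasis.combination, smul_add, Finset.smul_sum,
    smul_smul]

/-- All roots of an orbit agree on `𝔥_0`, so the whole orbit sum is a weight vector for `y`. -/
lemma lie_vec {y : H} (hy : ν.lin y = y) {m : ℕ} {α : Weight ℂ H 𝔤} (hα : α ∈ B.weights m) :
    ⁅(y : 𝔤), B.vec m α⁆ = α y • B.vec m α := by
  have hE := B.E_mem α (B.mem_root_of_mem_weights hα)
  have h : ∀ j, ⁅(y : 𝔤), (ν.lin ^ j) (B.E α)⁆ = α y • (ν.lin ^ j) (B.E α) := fun j => by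
    rw [← DiagramAutomorphism.perm_pow_apply_of_lin_eq hy α j]
    exact lie_eq_smul_of_mem_rootSpace (ν.lin_pow_mem_rootSpace hE j) y
  by_cases hp : ν.perm α = α
  · rw [B.vec_of_perm_eq hp]
    simpa using h 0
  · rw [B.vec_of_perm_ne hp, lie_sum, Finset.smul_sum]
    exact Finset.sum_congr rfl fun j _ => by rw [lie_smul, h, smul_comm]

lemma laxComponent_add_tau (hτ : 0 < τ.im) {y : H} (hy : ν.lin y = y)
    (hxy : ∀ α : Weight ℂ H 𝔤, α y = avgRoot ν r α x) {m : ℕ} (hm : m < r) (z : ℂ) :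
    laxComponent B τ x p m (z + τ) = AdExp (y : 𝔤) (laxComponent B τ x p m z) := by
  have h1 : cartanCoeff τ r p m (z + τ) = cartanCoeff τ r p m z := by
    funext k
    by_cases h : m = 0
    · simp [cartanCoeff, h]
    · simp [cartanCoeff, h, kroneckerTwist_add_tau hτ, e_zero]
  have h2 : weightCoeff ν τ r x p m (z + τ) =
      fun α => e (avgRoot ν r α x) * weightCoeff ν τ r x p m z α := by
    funext α
    simp [weightCoeff, kroneckerTwist_add_tau hτ, mul_left_comm]
  simp only [laxComponent_eq, h1, h2, AdaptedBasis.combination, map_add, map_sum, map_smul]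
  congr 1
  · refine Finset.sum_congr rfl fun k hk => ?_
    have hk := (B.h_mem m hm k (Finset.mem_range.1 hk)).1
    have h0 : ⁅(y : 𝔤), B.h m k⁆ = (0 : ℂ) • B.h m k := by
      have := trivial_lie_zero H H y ⟨B.h m k, hk⟩
      rw [zero_smul]
      exact congrArg Subtype.val this
    rw [AdExp_of_lie_eq_smul h0, e_zero, one_smul]
  · refine Finset.sum_congr rfl fun α hα => ?_
    rw [AdExp_of_lie_eq_smul (lie_vec hy hα), hxy, smul_smul, mul_comm]

lemma IsRegular.neg_notMem (hreg : IsRegular B τ x) {m : ℕ} (hm : m < r) {α : Weight ℂ H 𝔤}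
    (hα : α ∈ B.weights m) :
    -avgRoot ν r α x + ((-m : ℤ) : ℂ) * τ / r ∉ periodLattice τ := by
  have := hreg m hm α hα
  rw [← neg_mem_periodLattice] at this
  convert this using 2
  push_cast
  ring

lemma neg_natCast_mul_div_notMem (hτ : 0 < τ.im) {m : ℕ} (h0 : m ≠ 0) (hm : m < r) :
    (0 : ℂ) + ((-m : ℤ) : ℂ) * τ / r ∉ periodLattice τ := by
  have := natCast_mul_div_notMem_periodLattice hτ h0 hm
  rw [← neg_mem_periodLattice] at this
  convert this using 2
  push_cast
  ring

lemma apply_laxComponent (f : Module.Dual ℂ 𝔤) (m : ℕ) (z : ℂ) :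
    f (laxComponent B τ x p m z) =
      ∑ k ∈ Finset.range (B.n m), cartanCoeff τ r p m z k * f (B.h m k) +
        ∑ α ∈ B.weights m, weightCoeff ν τ r x p m z α * f (B.vec m α) := by
  simp [laxComponent_eq, AdaptedBasis.combination]

lemma differentiableAt_laxComponent (hτ : 0 < τ.im) (hreg : IsRegular B τ x) {m : ℕ} (hm : m < r)
    (f : Module.Dual ℂ 𝔤) {z : ℂ} (hz : z ∉ periodLattice τ) :
    DifferentiableAt ℂ (fun w => f (laxComponent B τ x p m w)) z := by
  simp only [apply_laxComponent]
  refine DifferentiableAt.add (DifferentiableAt.fun_sum fun k _ => ?_)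
    (DifferentiableAt.fun_sum fun α hα => ?_)
  · refine DifferentiableAt.mul_const ?_ _
    unfold cartanCoeff
    split_ifs with h
    · exact differentiableAt_const _
    · exact (differentiableAt_kroneckerTwist hτ (neg_natCast_mul_div_notMem hτ h hm) hz).const_mul _
  · exact ((differentiableAt_kroneckerTwist hτ (hreg.neg_notMem hm hα) hz).const_mul _).mul_const _

lemma tendsto_mul_laxComponent (hτ : 0 < τ.im) (hreg : IsRegular B τ x) {m : ℕ} (hm : m < r)
    (f : Module.Dual ℂ 𝔤) :
    Tendsto (fun z => z * f (laxComponent B τ x p m z)) (𝓝[≠] 0)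
      (𝓝 (f (residueComponent B p m))) := by
  have h0 : f (residueComponent B p m) =
      ∑ k ∈ Finset.range (B.n m), (if m = 0 then 0 else p.spinH m k) * f (B.h m k) +
        ∑ α ∈ B.weights m, p.spinR m α * f (B.vec m α) := by
    rw [residueComponent_eq, AdaptedBasis.combination, map_add, map_sum, map_sum]
    simp only [map_smul, smul_eq_mul]
  simp only [apply_laxComponent, h0, mul_add, Finset.mul_sum]
  refine Tendsto.add (tendsto_finsetSum _ fun k _ => ?_) (tendsto_finsetSum _ fun α hα => ?_)
  · simp only [← mul_assoc]
    refine Tendsto.mul_const _ ?_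
    unfold cartanCoeff
    split_ifs with h
    -- The momenta are constant in `z`, so the residue has no component in `𝔥_0`.
    · have : Tendsto (fun z : ℂ => z * p.v k) (𝓝 0) (𝓝 (0 * p.v k)) :=
        tendsto_id.mul_const _
      rw [zero_mul] at this
      exact this.mono_left nhdsWithin_le_nhds
    · have := (tendsto_mul_kroneckerTwist hτ (neg_natCast_mul_div_notMem hτ h hm)).const_mul
        (p.spinH m k)
      rw [mul_one] at this
      exact this.congr fun z => by ring
  · have := ((tendsto_mul_kroneckerTwist hτ (hreg.neg_notMem hm hα)).const_mul
      (p.spinR m α)).mul_const (f (B.vec m α))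
    rw [mul_one] at this
    exact this.congr fun z => by rw [weightCoeff]; ring

lemma form_laxComponent_zero (hrp : r.Prime) (hν : ν.lin ^ r = 1) (hτ : 0 < τ.im)
    (hreg : IsRegular B τ x) {z : ℂ} (hz : z ∉ periodLattice τ) :
    (1 / 2) * form c (laxComponent B τ x p 0 z) (laxComponent B τ x p 0 z) =
      hamZero B τ x p + eisensteinTwo τ z *
        ((1 / 2) * form c (residueComponent B p 0) (residueComponent B p 0)) := by
  rw [laxComponent_eq, residueComponent_eq,
    AdaptedBasis.form_combination hrp hν hrp.pos (by simp),
    AdaptedBasis.form_combination hrp hν hrp.pos (by simp), hamZero]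
  have h1 : ∀ α ∈ B.weights 0, B.len α * weightCoeff ν τ r x p 0 z α *
      weightCoeff ν τ r x p 0 z (-α) =
      eisensteinTwo τ z * (B.len α * p.spinR 0 α * p.spinR 0 (-α)) -
        B.len α * p.spinR 0 α * p.spinR 0 (-α) * eisensteinTwo τ (avgRoot ν r α x) := by
    intro α hα
    have hu : avgRoot ν r α x ∉ periodLattice τ := by simpa using hreg 0 hrp.pos α hα
    have := kroneckerTwist_zero_mul (r := r) hτ hu hz
    rw [weightCoeff, weightCoeff, DiagramAutomorphism.avgRoot_neg, neg_neg]
    linear_combination (B.len α * p.spinR 0 α * p.spinR 0 (-α)) * this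
  rw [Finset.sum_congr rfl h1, Finset.sum_sub_distrib, ← Finset.mul_sum]
  simp only [cartanCoeff, if_true, mul_zero, Finset.sum_const_zero, pow_two]
  ring

lemma form_laxComponent (hrp : r.Prime) (hν : ν.lin ^ r = 1) (hτ : 0 < τ.im)
    (hreg : IsRegular B τ x) {z : ℂ} (hz : z ∉ periodLattice τ) {m : ℕ} (hm0 : m ≠ 0)
    (hm : m < r) :
    (1 / 2) * form c (laxComponent B τ x p m z) (laxComponent B τ x p (r - m) z) =
      (-(1 / 2) * ∑ k ∈ Finset.range (B.n m),
          p.spinH m k * p.spinH (r - m) k * eisensteinTwo τ (m * τ / r) -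
        (1 / 2) * ∑ α ∈ B.weights (r - m),
          B.len α * p.spinR (r - m) α * p.spinR m (-α) *
            eisensteinTwo τ (avgRoot ν r α x - m * τ / r)) +
      eisensteinTwo τ z *
        ((1 / 2) * form c (residueComponent B p m) (residueComponent B p (r - m))) := by
  have hr : (r : ℂ) ≠ 0 := by exact_mod_cast hrp.ne_zero
  have hm' : r - m < r := by omega
  have hm0' : r - m ≠ 0 := by omega
  have hrm : r - (r - m) = m := by omega
  have hmod : m = (r - (r - m)) % r := by rw [hrm, Nat.mod_eq_of_lt hm]
  have hn : B.n (r - m) = B.n m := by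
    rw [← B.n_symm m hm, Nat.mod_eq_of_lt hm']
  -- Swapping the arguments makes the root sum run over the weights of degree `r - m`, as in the
  -- Hamiltonian.
  rw [form_comm, form_comm (residueComponent B p m), laxComponent_eq, laxComponent_eq,
    residueComponent_eq, residueComponent_eq, AdaptedBasis.form_combination hrp hν hm' hmod,
    AdaptedBasis.form_combination hrp hν hm' hmod, hn]
  -- The product formula in degree `r - m` yields `E₂(u + (r-m)τ/r)`; periodicity rewrites the
  -- argument as `u - mτ/r`.
  have hmul : ∀ u : ℂ, u + (r - m : ℕ) * τ / r ∉ periodLattice τ →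
      kroneckerTwist τ r (-(r - m : ℕ)) (-u) z * kroneckerTwist τ r (-m) u z =
        eisensteinTwo τ z - eisensteinTwo τ (u - m * τ / r) := by
    intro u hu
    have h1 := kroneckerTwist_mul hτ hm' hu hz
    have h2 : u + (r - m : ℕ) * τ / r = u - m * τ / r + τ := by
      rw [Nat.cast_sub hm.le]; field_simp; ring
    have h3 : u - m * τ / r ∉ periodLattice τ := fun h => hu (by
      rw [h2]
      have := (add_int_mem_periodLattice (τ := τ) 0 1).2 h
      simpa using this)
    rw [hrm, h2, eisensteinTwo_add_tau hτ h3] at h1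
    exact h1
  have h1 : ∀ k ∈ Finset.range (B.n m), cartanCoeff τ r p (r - m) z k * cartanCoeff τ r p m z k =
      eisensteinTwo τ z * (p.spinH (r - m) k * p.spinH m k) -
        p.spinH m k * p.spinH (r - m) k * eisensteinTwo τ (m * τ / r) := by
    intro k _
    -- For the Cartan part `u = 0`, and evenness of `E₂` turns `-mτ/r` into `mτ/r`.
    have h := hmul 0 (by
      rw [zero_add]; exact natCast_mul_div_notMem_periodLattice hτ hm0' hm')
    rw [zero_sub, neg_zero, eisensteinTwo_neg hτ
      (natCast_mul_div_notMem_periodLattice hτ hm0 hm)] at h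
    rw [cartanCoeff, cartanCoeff, if_neg hm0, if_neg hm0']
    linear_combination (p.spinH (r - m) k * p.spinH m k) * h
  have h2 : ∀ α ∈ B.weights (r - m), B.len α * weightCoeff ν τ r x p (r - m) z α *
      weightCoeff ν τ r x p m z (-α) =
      eisensteinTwo τ z * (B.len α * p.spinR (r - m) α * p.spinR m (-α)) -
        B.len α * p.spinR (r - m) α * p.spinR m (-α) *
          eisensteinTwo τ (avgRoot ν r α x - m * τ / r) := by
    intro α hα
    have h := hmul _ (hreg (r - m) hm' α hα)
    rw [weightCoeff, weightCoeff, DiagramAutomorphism.avgRoot_neg, neg_neg]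
    linear_combination (B.len α * p.spinR (r - m) α * p.spinR m (-α)) * h
  rw [Finset.sum_congr rfl h1, Finset.sum_congr rfl h2, Finset.sum_sub_distrib,
    Finset.sum_sub_distrib, ← Finset.mul_sum, ← Finset.mul_sum]
  simp only [if_neg hm0, if_neg hm0']
  ring

end Lax

end TwistedCM

/-- `u` lies in `𝔥_0`. The shift `ϖ` is any element of the weight lattice (for simply laced `𝔤`
identified with `{x ∈ 𝔥 | α(x) ∈ ℤ for all roots α}`): `ϖ = 0` is the adjoint bundle, and a
fundamental weight `ϖ = ϖ_j` with `ν ϖ_j - ϖ_j = ξ` is the bundle of characteristic class `e(ξ)`. -/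
theorem mainTheorem8 {𝔤 : Type*} [LieRing 𝔤] [LieAlgebra ℂ 𝔤] [FiniteDimensional ℂ 𝔤]
    [LieAlgebra.IsSimple ℂ 𝔤] (H : LieSubalgebra ℂ 𝔤) [H.IsCartanSubalgebra]
    (b : (LieAlgebra.IsKilling.rootSystem H).Base)
    (ν : TwistedCM.DiagramAutomorphism H b) (r : ℕ) (hr : r = 2 ∨ r = 3)
    (hν : orderOf ν.lin = r)
    (c : ℂ) (hc : c ≠ 0) (B : TwistedCM.AdaptedBasis ν r c)
    (τ : ℂ) (hτ : 0 < τ.im)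
    (u : H) (hu : ν.lin (u : 𝔤) = u)
    (ϖ : H) (hϖ : ∀ α ∈ H.root, ∃ k : ℤ, α ϖ = k)
    (hreg : TwistedCM.IsRegular B τ (u + ϖ))
    (p : TwistedCM.PhasePoint H) :
    -- quasi-periodicity in the twisted direction: `ν (L(t)) = L(t ω⁻¹)`, with `t = e(z / r)`
    (∀ z ∉ TwistedCM.periodLattice τ,
      ν.lin (TwistedCM.lax B τ (u + ϖ) p z) = TwistedCM.lax B τ (u + ϖ) p (z - 1)) ∧
    -- quasi-periodicity along `τ`: the transition operator is `Ad` of `e` of the invariant part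
    -- of `u + ϖ`, which is `u` itself when `ϖ = 0`
    (∀ z ∉ TwistedCM.periodLattice τ,
      TwistedCM.lax B τ (u + ϖ) p (z + τ) =
        TwistedCM.AdExp ((u : 𝔤) + TwistedCM.invariantPart ν r (ϖ : 𝔤))
          (TwistedCM.lax B τ (u + ϖ) p z)) ∧
    -- holomorphy off the lattice, and a simple pole at `z = 0` with residue `S`
    (∀ f : Module.Dual ℂ 𝔤,
      (∀ z ∉ TwistedCM.periodLattice τ,
        DifferentiableAt ℂ (fun w => f (TwistedCM.lax B τ (u + ϖ) p w)) z) ∧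
      Filter.Tendsto (fun z => z * f (TwistedCM.lax B τ (u + ϖ) p z)) (𝓝[≠] 0)
        (𝓝 (f (TwistedCM.residue B p)))) ∧
    -- the Hamiltonian
    (∀ z ∉ TwistedCM.periodLattice τ,
      (1 / 2) * TwistedCM.form c (TwistedCM.laxComponent B τ (u + ϖ) p 0 z)
          (TwistedCM.laxComponent B τ (u + ϖ) p 0 z) =
        TwistedCM.hamZero B τ (u + ϖ) p + TwistedCM.eisensteinTwo τ z *
          ((1 / 2) * TwistedCM.form c (TwistedCM.residueComponent B p 0)
            (TwistedCM.residueComponent B p 0)) ∧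
      (1 / 2) * ∑ m ∈ Finset.Ico 1 r,
          TwistedCM.form c (TwistedCM.laxComponent B τ (u + ϖ) p m z)
            (TwistedCM.laxComponent B τ (u + ϖ) p (r - m) z) =
        TwistedCM.hamPrime B τ (u + ϖ) p + TwistedCM.eisensteinTwo τ z *
          ((1 / 2) * ∑ m ∈ Finset.Ico 1 r,
            TwistedCM.form c (TwistedCM.residueComponent B p m)
              (TwistedCM.residueComponent B p (r - m))) ∧
      (1 / 2) * TwistedCM.form c (TwistedCM.lax B τ (u + ϖ) p z)
          (TwistedCM.lax B τ (u + ϖ) p z) =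
        (TwistedCM.hamZero B τ (u + ϖ) p + TwistedCM.hamPrime B τ (u + ϖ) p) +
          TwistedCM.eisensteinTwo τ z * TwistedCM.casimir B p) := by
  have hrp : r.Prime := by rcases hr with rfl | rfl <;> norm_num
  have hν' : ν.lin ^ r = 1 := hν ▸ pow_orderOf_eq_one ν.lin
  have hlin : ∀ (z : ℂ), ∀ m < r, ν.lin (TwistedCM.laxComponent B τ (u + ϖ) p m z) =
      TwistedCM.e (m / r) • TwistedCM.laxComponent B τ (u + ϖ) p m z := fun z m hm => by
    rw [TwistedCM.laxComponent_eq, TwistedCM.AdaptedBasis.lin_combination hν' hm]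
  have hlinS : ∀ m < r, ν.lin (TwistedCM.residueComponent B p m) =
      TwistedCM.e (m / r) • TwistedCM.residueComponent B p m := fun m hm => by
    rw [TwistedCM.residueComponent_eq, TwistedCM.AdaptedBasis.lin_combination hν' hm]
  refine ⟨fun z _ => ?_, fun z _ => ?_, fun f => ⟨fun z hz => ?_, ?_⟩, fun z hz => ?_⟩
  · rw [TwistedCM.lax, TwistedCM.lax, map_sum]
    refine Finset.sum_congr rfl fun m hm => ?_
    rw [hlin z m (Finset.mem_range.1 hm), TwistedCM.laxComponent_sub_one hτ]
  -- The element `u + w` is `ν`-invariant and its root values are the averaged roots at `u + ϖ`, as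
  -- the shift by `τ` requires.
  · let w : H := ⟨TwistedCM.invariantPart ν r ϖ,
      TwistedCM.DiagramAutomorphism.invariantPart_mem ϖ.2⟩
    have hw : ν.lin ((u + w : H) : 𝔤) = (u + w : H) := by
      rw [H.coe_add, map_add, hu, TwistedCM.DiagramAutomorphism.lin_invariantPart hν']
    have hxw : ∀ α : LieModule.Weight ℂ H 𝔤,
        α (u + w) = TwistedCM.avgRoot ν r α (u + ϖ) := fun α => by
      rw [TwistedCM.DiagramAutomorphism.avgRoot_add,
        TwistedCM.DiagramAutomorphism.avgRoot_of_lin_eq hrp.ne_zero hu,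
        ← TwistedCM.DiagramAutomorphism.apply_invariantPart hν']
      exact map_add (α.toLinear ℂ H 𝔤) _ _
    have huw : (u : 𝔤) + TwistedCM.invariantPart ν r (ϖ : 𝔤) = (u + w : H) := rfl
    rw [TwistedCM.lax, TwistedCM.lax, map_sum, huw]
    exact Finset.sum_congr rfl fun m hm =>
      TwistedCM.laxComponent_add_tau hτ hw hxw (Finset.mem_range.1 hm) z
  · simp only [TwistedCM.lax, map_sum]
    exact DifferentiableAt.fun_sum fun m hm =>
      TwistedCM.differentiableAt_laxComponent hτ hreg (Finset.mem_range.1 hm) f hz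
  · simp only [TwistedCM.lax, TwistedCM.residue, map_sum, Finset.mul_sum]
    exact tendsto_finsetSum _ fun m hm =>
      TwistedCM.tendsto_mul_laxComponent hτ hreg (Finset.mem_range.1 hm) f
  · have h0 := TwistedCM.form_laxComponent_zero (p := p) hrp hν' hτ hreg hz
    have h1 : (1 / 2) * ∑ m ∈ Finset.Ico 1 r,
          TwistedCM.form c (TwistedCM.laxComponent B τ (u + ϖ) p m z)
            (TwistedCM.laxComponent B τ (u + ϖ) p (r - m) z) =
        TwistedCM.hamPrime B τ (u + ϖ) p + TwistedCM.eisensteinTwo τ z *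
          ((1 / 2) * ∑ m ∈ Finset.Ico 1 r,
            TwistedCM.form c (TwistedCM.residueComponent B p m)
              (TwistedCM.residueComponent B p (r - m))) := by
      rw [TwistedCM.hamPrime, Finset.mul_sum, Finset.mul_sum, Finset.mul_sum,
        ← Finset.sum_add_distrib]
      refine Finset.sum_congr rfl fun m hm => ?_
      have hm := Finset.mem_Ico.1 hm
      exact TwistedCM.form_laxComponent hrp hν' hτ hreg hz (by omega) hm.2
    refine ⟨h0, h1, ?_⟩
    rw [TwistedCM.casimir, TwistedCM.lax, TwistedCM.residue,
      TwistedCM.form_sum_sum_of_lin_eq hrp.pos (hlin z),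
      TwistedCM.form_sum_sum_of_lin_eq hrp.pos hlinS]
    linear_combination h0 + h1
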